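/- Let $K$ be a field containing $\mathbb{Q}$ and let $X=\{x_1,x_2,x_3,\dots\}$ be a countable set of indeterminates. Write $[X]$ for the free abelian monoid of monomials in $X$, $|m|$ for the total degree of $m\in[X]$, and $\operatorname{supp}(f)$ for the set of monomials with nonzero coefficient in $f\in K[[X]]$. Let $R\subset K[[X]]$ be the large polynomial ring, that is, the subring of all power series $f$ for which $\{|m| : m\in\operatorname{supp}(f)\}$ is bounded. For each $n$ let $\rho_n\colon R\to K[x_1,\dots,x_n]$ be the truncation homomorphism, which keeps the monomials in $x_1,\dots,x_n$ and sends all other monomials to $0$; write $I|_n=\rho_n(I)$ for an ideal $I\subset R$. Fix $r\ge 1$ and a map $y\colon\{1,2,\dots\}\to\{1,\dots,r\}$, and let $\deg\colon[X]\to\mathbb{N}^r$ be the monoid homomorphism with $\deg(x_i)=e_{y(i)}$. An ideal $I\subset R$ is $r$-homogeneous if it contains all $\mathbb{N}^r$-homogeneous components of each of its elements. It is locally finitely generated if it is generated by a set of elements that are homogeneous with respect to total degree, with only finitely many in each degree. Let $>$ be a term order on $[X]$, that is, a total order that is compatible with multiplication and whose restriction to the set of variables $X$ is order-isomorphic to the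 reverse of $(\mathbb{N},<)$. For $0\ne f\in R$ let $\mathrm{in}_>(f)$ be the largest monomial in $\operatorname{supp}(f)$, and for an ideal $I\subset R$ let $\mathrm{in}_>(I)$ be the ideal of $R$ generated by all $\mathrm{in}_>(f)$, $0\neq f\in I$. For a monomial ideal $J\subset R$ define its $[X]$-graded Hilbert numerator $$p(J)=\Bigl(\prod_{i\ge1}(1-x_i)\Bigr)\cdot\sum_{m\in[X],\,m\notin J}m\ \in\ \mathbb{Z}[[X]].$$ Let $\mathcal{S}\subset\mathbb{Z}[[X]]$ be the subring of all series that have only finitely many terms in each total degree, and let $\mathrm{Collapse}\colon\mathcal{S}\to\mathbb{Z}[[t_1,\dots,t_r]]$ be the substitution $x_i\mapsto t_{y(i)}$. **Theorem.** Let $I\subset R$ be an $r$-homogeneous locally finitely generated ideal. Then: 1. for every $n$ there is a (unique) polynomial $g_n\in\mathbb{Z}[t_1,\dots,t_r]$ such that $$\frac{g_n}{\prod_{i=1}^n(1-t_{y(i)})}=\sum_{\alpha\in\mathbb{N}^r}\dim_K\bigl(K[x_1,\dots,x_n]/I|_n\bigr)_\alpha\,t^\alpha$$ is the $\mathbb{N}^r$-graded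 Hilbert series of $K[x_1,\dots,x_n]/I|_n$; 2. $p(\mathrm{in}_>(I))\in\mathcal{S}$, so that $\mathrm{Collapse}(p(\mathrm{in}_>(I)))\in\mathbb{Z}[[t_1,\dots,t_r]]$ is defined; 3. $g_n\to\mathrm{Collapse}(p(\mathrm{in}_>(I)))$ as $n\to\infty$ in the $(t_1,\dots,t_r)$-adic topology of $\mathbb{Z}[[t_1,\dots,t_r]]$. -/

import Mathlib

open Filter

namespace LargePoly

noncomputable section

/-! Monomials in the variables `x_0, x_1, x_2, …` (the set `X`) are finitely supported exponent
vectors `ℕ →₀ ℕ`, so that `[X]` is `ℕ →₀ ℕ` written additively, and `K[[X]]` is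
`MvPowerSeries ℕ K`. -/

/-- The large polynomial ring: all power series in countably many variables in which the total
degrees of the occurring monomials are bounded. -/
def RP (K : Type*) [Field K] : Subalgebra K (MvPowerSeries ℕ K) where
  carrier := {f | ∃ d : ℕ, ∀ m : ℕ →₀ ℕ, MvPowerSeries.coeff m f ≠ 0 → m.degree ≤ d}
  mul_mem' := by
    classical
    rintro f g ⟨d, hd⟩ ⟨e, he⟩
    refine ⟨d + e, fun m hm => ?_⟩
    rw [MvPowerSeries.coeff_mul] at hm
    obtain ⟨p, hp, hne⟩ := Finset.exists_ne_zero_of_sum_ne_zero hm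
    rw [Finset.HasAntidiagonal.mem_antidiagonal] at hp
    rw [← hp, map_add]
    exact add_le_add (hd _ (left_ne_zero_of_mul hne)) (he _ (right_ne_zero_of_mul hne))
  add_mem' := by
    rintro f g ⟨d, hd⟩ ⟨e, he⟩
    refine ⟨max d e, fun m hm => ?_⟩
    by_cases hf : MvPowerSeries.coeff m f = 0
    · refine (he m fun hg => hm ?_).trans (le_max_right d e)
      rw [map_add, hf, hg, add_zero]
    · exact (hd m hf).trans (le_max_left d e)
  algebraMap_mem' c := by
    classical
    refine ⟨0, fun m hm => ?_⟩
    rw [MvPowerSeries.algebraMap_apply, MvPowerSeries.coeff_C] at hm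
    by_cases h : m = 0
    · simp [h]
    · simp [h] at hm

/-- The monomial `m`, as an element of the large polynomial ring. -/
def mono (K : Type*) [Field K] (m : ℕ →₀ ℕ) : RP K :=
  ⟨MvPowerSeries.monomial m 1, m.degree, fun m' hm' => by
    classical
    rw [MvPowerSeries.coeff_monomial] at hm'
    by_cases h : m' = m
    · simp [h]
    · simp [h] at hm'⟩

/-- For `f` in the large polynomial ring, only finitely many monomials in `x_0, …, x_{n-1}`
occur in `f`. -/
theorem truncate_finite {K : Type*} [Field K] (n : ℕ) (f : RP K) :
    {m : Fin n →₀ ℕ | MvPowerSeries.coeff m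
      (MvPowerSeries.killCompl (R := K) (Fin.valEmbedding (n := n))
        (f : MvPowerSeries ℕ K)) ≠ 0}.Finite := by
  obtain ⟨f, d, hd⟩ := f
  refine (Finsupp.finite_of_degree_le (σ := Fin n) d).subset fun m hm => ?_
  have h := hd _ (by simpa [MvPowerSeries.coeff_killCompl] using hm)
  rw [Set.mem_ofPred_eq]
  refine le_of_eq_of_le ?_ h
  rw [Finsupp.degree_apply, Finsupp.degree_apply, Finsupp.support_embDomain, Finset.sum_map]
  exact Finset.sum_congr rfl fun i _ => (Finsupp.embDomain_apply_self _ _ _).symm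

/-- The underlying function of the truncation homomorphism. -/
def truncateFun {K : Type*} [Field K] (n : ℕ) (f : RP K) : MvPolynomial (Fin n) K :=
  ∑ m ∈ (truncate_finite n f).toFinset, MvPolynomial.monomial m (MvPowerSeries.coeff m
      (MvPowerSeries.killCompl (R := K) (Fin.valEmbedding (n := n)) (f : MvPowerSeries ℕ K)))

theorem coe_truncateFun {K : Type*} [Field K] (n : ℕ) (f : RP K) :
    (truncateFun n f : MvPowerSeries (Fin n) K) =
      MvPowerSeries.killCompl (R := K) (Fin.valEmbedding (n := n)) (f : MvPowerSeries ℕ K) := by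
  classical
  ext m
  rw [MvPolynomial.coeff_coe, truncateFun, MvPolynomial.coeff_sum]
  simp only [MvPolynomial.coeff_monomial, Finset.sum_ite_eq', Set.Finite.mem_toFinset,
    Set.mem_ofPred_eq]
  split_ifs with h
  · rfl
  · exact (not_not.mp h).symm

/-- The truncation homomorphism from the large polynomial ring to `K[x_0, …, x_{n-1}]`: it keeps
the monomials that involve only the first `n` variables and kills all others. -/
def truncate (K : Type*) [Field K] (n : ℕ) : RP K →+* MvPolynomial (Fin n) K where
  toFun := truncateFun n
  map_one' := MvPolynomial.coe_injective (Fin n) K (by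
    rw [coe_truncateFun, OneMemClass.coe_one, map_one, MvPolynomial.coe_one])
  map_mul' f g := MvPolynomial.coe_injective (Fin n) K (by
    rw [MvPolynomial.coe_mul]
    simp only [coe_truncateFun, MulMemClass.coe_mul, map_mul])
  map_zero' := MvPolynomial.coe_injective (Fin n) K (by
    rw [coe_truncateFun, ZeroMemClass.coe_zero, map_zero, MvPolynomial.coe_zero])
  map_add' f g := MvPolynomial.coe_injective (Fin n) K (by
    rw [MvPolynomial.coe_add]
    simp only [coe_truncateFun, AddMemClass.coe_add, map_add])

/-! ### Gradings -/

/-- The `ℕ^r`-multidegree of a monomial, where `x_i` has degree the basis vector `e_{y i}`. -/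
def mdeg {r : ℕ} (y : ℕ → Fin r) : (ℕ →₀ ℕ) →+ (Fin r →₀ ℕ) :=
  Finsupp.weight fun i => Finsupp.single (y i) 1

/-- The component of multidegree `α` of an element of the large polynomial ring. -/
def component {K : Type*} [Field K] {r : ℕ} (y : ℕ → Fin r) (α : Fin r →₀ ℕ) (f : RP K) : RP K :=
  ⟨fun m => if mdeg y m = α then MvPowerSeries.coeff m (f : MvPowerSeries ℕ K) else 0, by
    obtain ⟨f, d, hd⟩ := f
    refine ⟨d, fun m hm => hd m fun h0 => hm ?_⟩
    change (if mdeg y m = α then MvPowerSeries.coeff m f else 0) = 0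
    rw [h0, ite_self]⟩

/-- An ideal is `r`-homogeneous if it contains all multigraded components of its elements. -/
def IsMultihomogeneous {K : Type*} [Field K] {r : ℕ} (y : ℕ → Fin r) (I : Ideal (RP K)) : Prop :=
  ∀ f ∈ I, ∀ α : Fin r →₀ ℕ, component y α f ∈ I

/-- An ideal is locally finitely generated if it is generated by elements that are homogeneous
for the total degree, finitely many in each degree. -/
def IsLFG {K : Type*} [Field K] (I : Ideal (RP K)) : Prop :=
  ∃ F : ℕ → Set (RP K),
    (∀ d, (F d).Finite) ∧
    (∀ d, ∀ f ∈ F d, ∀ m : ℕ →₀ ℕ,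
      MvPowerSeries.coeff m (f : MvPowerSeries ℕ K) ≠ 0 → m.degree = d) ∧
    I = Ideal.span (⋃ d, F d)

/-! ### Term orders and initial ideals -/

/-- A term order on `[X]`: a total order (`lt a b` means that `a` is smaller than `b`) that is
compatible with multiplication of monomials and whose restriction to the set of variables is
order-isomorphic to the reversed natural numbers. -/
structure IsTermOrder (lt : (ℕ →₀ ℕ) → (ℕ →₀ ℕ) → Prop) : Prop where
  isStrictTotalOrder : IsStrictTotalOrder (ℕ →₀ ℕ) lt
  add_right : ∀ a b c : ℕ →₀ ℕ, lt a b → lt (a + c) (b + c)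
  on_vars : Nonempty
    ((fun i j : ℕ => lt (Finsupp.single i 1) (Finsupp.single j 1)) ≃r
      (fun i j : ℕ => j < i))

/-- `m` is the initial monomial of `f`, the largest element of the support of `f`. -/
def IsInitial {K : Type*} [Field K] (lt : (ℕ →₀ ℕ) → (ℕ →₀ ℕ) → Prop) (f : RP K)
    (m : ℕ →₀ ℕ) : Prop :=
  MvPowerSeries.coeff m (f : MvPowerSeries ℕ K) ≠ 0 ∧
    ∀ m' : ℕ →₀ ℕ, MvPowerSeries.coeff m' (f : MvPowerSeries ℕ K) ≠ 0 → m' = m ∨ lt m' m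

/-- The initial ideal, generated by the initial monomials of the elements of `I`. -/
def initialIdeal {K : Type*} [Field K] (lt : (ℕ →₀ ℕ) → (ℕ →₀ ℕ) → Prop) (I : Ideal (RP K)) :
    Ideal (RP K) :=
  Ideal.span {g | ∃ f ∈ I, ∃ m, IsInitial lt f m ∧ g = mono K m}

/-! ### The `[X]`-graded Hilbert numerator of a monomial ideal -/

/-- The monoid ideal `J ∩ [X]` of all monomials contained in `J`. -/
def monomialsOf {K : Type*} [Field K] (J : Ideal (RP K)) : Set (ℕ →₀ ℕ) :=
  {m | mono K m ∈ J}

open Classical in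
/-- The `[X]`-graded Hilbert series of (the complement of) a set of monomials. -/
def hilbertX (M : Set (ℕ →₀ ℕ)) : MvPowerSeries ℕ ℤ :=
  fun m => if m ∈ M then 0 else 1

open Classical in
/-- The Möbius series `∏ i, (1 - x_i)`: a squarefree monomial of degree `k` has coefficient
`(-1) ^ k`, all other monomials have coefficient zero. -/
def moebiusX : MvPowerSeries ℕ ℤ :=
  fun m => if ∀ i, m i ≤ 1 then (-1) ^ m.degree else 0

/-- The `[X]`-graded Hilbert numerator of a monomial ideal. -/
def numeratorX {K : Type*} [Field K] (J : Ideal (RP K)) : MvPowerSeries ℕ ℤ :=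
  moebiusX * hilbertX (monomialsOf J)

/-! ### Collapsing -/

/-- The subring `𝒮` of `ℤ[[X]]` of all series with only finitely many terms in each total
degree. -/
def collapsible : Subring (MvPowerSeries ℕ ℤ) where
  carrier := {f | ∀ d : ℕ, {m : ℕ →₀ ℕ | m.degree = d ∧ MvPowerSeries.coeff m f ≠ 0}.Finite}
  mul_mem' := by
    classical
    intro f g hf hg d
    refine ((Set.finite_Iic d).biUnion fun a _ => (Set.finite_Iic d).biUnion fun b _ =>
      (hf a).image2 (· + ·) (hg b)).subset ?_
    rintro m ⟨hm, hne⟩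
    rw [MvPowerSeries.coeff_mul] at hne
    obtain ⟨p, hp, hne⟩ := Finset.exists_ne_zero_of_sum_ne_zero hne
    rw [Finset.HasAntidiagonal.mem_antidiagonal] at hp
    have hd : p.1.degree + p.2.degree = d := by rw [← map_add, hp, hm]
    simp only [Set.mem_iUnion]
    exact ⟨p.1.degree, Set.mem_Iic.2 (by omega), p.2.degree, Set.mem_Iic.2 (by omega),
      p.1, ⟨rfl, left_ne_zero_of_mul hne⟩, p.2, ⟨rfl, right_ne_zero_of_mul hne⟩, hp⟩
  one_mem' := by
    classical
    intro d
    refine (Set.finite_singleton (0 : ℕ →₀ ℕ)).subset ?_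
    rintro m ⟨-, hm⟩
    by_contra h
    rw [Set.mem_singleton_iff] at h
    exact hm (by rw [MvPowerSeries.coeff_one, if_neg h])
  add_mem' := by
    intro f g hf hg d
    refine ((hf d).union (hg d)).subset ?_
    rintro m ⟨hm, hne⟩
    by_cases h : MvPowerSeries.coeff m f = 0
    · refine Or.inr ⟨hm, fun h' => hne ?_⟩
      rw [map_add, h, h', add_zero]
    · exact Or.inl ⟨hm, h⟩
  zero_mem' := by
    intro d
    simp
  neg_mem' := by
    intro f hf d
    simpa using hf d

/-- The substitution `x_i ↦ t_{y i}` from `𝒮` to `ℤ[[t_1, …, t_r]]`: the coefficient of `t^α` is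
the sum, with finitely many nonzero terms, of the coefficients of the monomials of
multidegree `α`. -/
def collapse {r : ℕ} (y : ℕ → Fin r) (f : collapsible) : MvPowerSeries (Fin r) ℤ :=
  fun α => ∑ᶠ (m : ℕ →₀ ℕ) (_ : mdeg y m = α), MvPowerSeries.coeff m (f : MvPowerSeries ℕ ℤ)

/-! ### The `ℕ^r`-graded Hilbert series in finitely many variables -/

/-- The `ℕ^r`-graded Hilbert series of `K[x_0, …, x_{n-1}] / J`, where `x_i` has
multidegree `e_{y i}`. The component of multidegree `α` of the quotient is the image of the space
of homogeneous polynomials of multidegree `α`. -/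
def hilbertSeries {K : Type*} [Field K] {r : ℕ} (y : ℕ → Fin r) {n : ℕ}
    (J : Ideal (MvPolynomial (Fin n) K)) : MvPowerSeries (Fin r) ℤ :=
  fun α => (Module.finrank K
    (Submodule.map (Ideal.Quotient.mkₐ K J).toLinearMap
      (MvPolynomial.weightedHomogeneousSubmodule K
        (fun i : Fin n => (Finsupp.single (y i) 1 : Fin r →₀ ℕ)) α)) : ℤ)

end

end LargePoly

/-!
The ideal is compared with its truncations through initial monomials.

*Initial monomials stabilize.* Fix a degree `d`. The variables are ordered like the reversed
natural numbers, so the monomials of one total degree contain no infinite ascending chain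
(`IsTermOrder.wellFounded_gt`), although they may contain infinite descending ones. (Nothing
is used about monomials of different degrees, so `1` need not be the smallest monomial.) Hence
division with remainder by finitely many homogeneous power series can be carried out by recursion from the
largest monomial downwards (`exists_remainder`), and Buchberger's algorithm can be run one degree
at a time: a locally finitely generated ideal has finitely many generators and finitely many
S-polynomials in each degree, and the remainders added in degree `k` create new S-pairs only in
degrees greater than `k` (`exists_groebner`). This yields a finite Gröbner basis of `I` up to degree
`d`. As soon as `n` is so large that all its initial monomials involve only the first `n` variables,
its truncation keeps these initial monomials, and the representations of the S-polynomials
truncate to representations, so Buchberger's criterion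
(`exists_isInitialFin_of_mem_multiples`) makes the truncation a Gröbner basis of `I|_n` up to
degree `d`. So one finite set of monomials generates, up to degree `d`, the initial ideal of `I` and
those of all `I|_n` with `n` large (`exists_common_generators`).

*Numerators are local.* The coefficient of `m` in the numerator of a set of monomials is an
alternating sum over the squarefree divisors of `m`. If some variable has a larger exponent in `m`
than in all generators, its terms cancel in pairs (`coeff_numerator_eq_zero`). This single fact
shows that the numerator of the initial ideal has finitely many terms in each degree, and, with
Dickson's lemma, that the numerator of every `in(I|_n)` is a polynomial; its image under
`x_i ↦ t_{y i}` is `g_n`, since the standard monomials form a basis of the quotient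
(`finrank_component_eq_card`). Up to degree `d` both numerators are given by the same formula from
the same generators, so that for large `n` the coefficients of `g_n` of degree at most `d` are those
of the collapsed numerator (`exists_coeff_rename_eq_collapse`).
-/

namespace LargePoly

noncomputable section

/-! ### Term orders -/

namespace IsTermOrder

variable {lt : (ℕ →₀ ℕ) → (ℕ →₀ ℕ) → Prop}

theorem irrefl (h : IsTermOrder lt) (a : ℕ →₀ ℕ) : ¬ lt a a :=
  have := h.isStrictTotalOrder
  irrefl_of lt a

theorem trans (h : IsTermOrder lt) {a b c : ℕ →₀ ℕ} (hab : lt a b) (hbc : lt b c) : lt a c :=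
  have := h.isStrictTotalOrder
  trans_of lt hab hbc

theorem asymm (h : IsTermOrder lt) {a b : ℕ →₀ ℕ} (hab : lt a b) : ¬ lt b a :=
  fun hba => h.irrefl a (h.trans hab hba)

theorem trichotomous (h : IsTermOrder lt) (a b : ℕ →₀ ℕ) : lt a b ∨ a = b ∨ lt b a :=
  have := h.isStrictTotalOrder
  trichotomous_of lt a b

theorem add_left (h : IsTermOrder lt) {a b : ℕ →₀ ℕ} (c : ℕ →₀ ℕ) (hab : lt a b) :
    lt (c + a) (c + b) := by
  rw [add_comm c a, add_comm c b]
  exact h.add_right a b c hab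

theorem eq_or_lt_add (h : IsTermOrder lt) {a b c d : ℕ →₀ ℕ} (hab : a = b ∨ lt a b)
    (hcd : c = d ∨ lt c d) : a + c = b + d ∨ lt (a + c) (b + d) := by
  rcases hab with rfl | hab
  · rcases hcd with rfl | hcd
    · exact Or.inl rfl
    · exact Or.inr (h.add_left a hcd)
  · rcases hcd with rfl | hcd
    · exact Or.inr (h.add_right a b c hab)
    · exact Or.inr (h.trans (h.add_right a b c hab) (h.add_left b hcd))

theorem eq_or_lt_sum (h : IsTermOrder lt) {ι : Type*} (s : Finset ι) {v w : ι → ℕ →₀ ℕ}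
    (hvw : ∀ i ∈ s, v i = w i ∨ lt (v i) (w i)) :
    ∑ i ∈ s, v i = ∑ i ∈ s, w i ∨ lt (∑ i ∈ s, v i) (∑ i ∈ s, w i) := by
  classical
  induction s using Finset.induction_on with
  | empty => exact Or.inl rfl
  | insert a s ha ih =>
    rw [Finset.sum_insert ha, Finset.sum_insert ha]
    exact h.eq_or_lt_add (hvw a (Finset.mem_insert_self a s))
      (ih fun i hi => hvw i (Finset.mem_insert_of_mem hi))

end IsTermOrder

theorem exists_sum_single_eq (m : ℕ →₀ ℕ) :
    ∃ w : Fin m.degree → ℕ, ∑ j, Finsupp.single (w j) 1 = m := by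
  suffices H : ∀ d (m : ℕ →₀ ℕ), m.degree = d →
      ∃ w : Fin d → ℕ, ∑ j, Finsupp.single (w j) 1 = m from H _ m rfl
  intro d
  induction d with
  | zero =>
    intro m hm
    exact ⟨fun _ => 0, by simpa using ((Finsupp.degree_eq_zero_iff m).1 hm).symm⟩
  | succ d ih =>
    intro m hm
    have hne : m ≠ 0 := by
      rintro rfl
      simp at hm
    obtain ⟨i, hi⟩ := Finsupp.ne_iff.1 hne
    have hle : Finsupp.single i 1 ≤ m := by
      rw [Finsupp.single_le_iff]
      exact Nat.one_le_iff_ne_zero.2 hi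
    have hadd : Finsupp.single i 1 + (m - Finsupp.single i 1) = m := add_tsub_cancel_of_le hle
    have hd : (m - Finsupp.single i 1).degree = d := by
      have := congrArg Finsupp.degree hadd
      rw [map_add, Finsupp.degree_single, hm] at this
      omega
    obtain ⟨w, hw⟩ := ih _ hd
    refine ⟨Fin.cons i w, ?_⟩
    rw [Fin.sum_univ_succ]
    simp only [Fin.cons_zero, Fin.cons_succ, hw, hadd]

/-- Within one total degree there are no infinite ascending chains of monomials: a sequence of
monomials of degree `d` is a sequence of `d`-tuples of variables, and since larger indices mean
smaller variables, the componentwise order on the tuples, which is a well-quasi-order, refines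
the reversed term order. -/
theorem IsTermOrder.wellFounded_gt {lt : (ℕ →₀ ℕ) → (ℕ →₀ ℕ) → Prop} (h : IsTermOrder lt) :
    WellFounded fun m' m : ℕ →₀ ℕ => lt m m' ∧ m.degree = m'.degree := by
  rw [wellFounded_iff_isEmpty_descending_chain]
  refine ⟨fun ⟨f, hf⟩ => ?_⟩
  obtain ⟨e⟩ := h.on_vars
  have hdeg : ∀ n, (f n).degree = (f 0).degree := fun n => by
    induction n with
    | zero => rfl
    | succ n ih => rw [← (hf n).2, ih]
  have hlt : ∀ i j, i < j → lt (f i) (f j) := fun i j hij => by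
    induction j, hij using Nat.le_induction with
    | base => exact (hf i).1
    | succ j _ ih => exact h.trans ih (hf j).1
  have hw : ∀ n, ∃ w : Fin (f 0).degree → ℕ, ∑ j, Finsupp.single (w j) 1 = f n := fun n => by
    rw [← hdeg n]
    exact exists_sum_single_eq (f n)
  choose w hw using hw
  obtain ⟨i, j, hij, hle⟩ := (wellQuasiOrdered_le (α := Fin (f 0).degree → ℕ))
    fun n k => e (w n k)
  have hle' : f j = f i ∨ lt (f j) (f i) := by
    rw [← hw i, ← hw j]
    refine h.eq_or_lt_sum _ fun k _ => ?_
    rcases (hle k).eq_or_lt with heq | hlt'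
    · exact Or.inl (by rw [e.injective heq])
    · exact Or.inr (e.map_rel_iff.1 hlt')
  rcases hle' with heq | hlt'
  · exact h.irrefl (f i) (by simpa [heq] using hlt i j hij)
  · exact h.asymm hlt' (hlt i j hij)

/-! ### Initial monomials -/

/-- The coefficient of the monomial `m` in an element of the large polynomial ring. -/
abbrev coef {K : Type*} [Field K] (m : ℕ →₀ ℕ) (f : RP K) : K :=
  MvPowerSeries.coeff m (f : MvPowerSeries ℕ K)

section Initial

variable {K : Type*} [Field K] {lt : (ℕ →₀ ℕ) → (ℕ →₀ ℕ) → Prop}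

theorem RP.ext {f g : RP K} (h : ∀ m, coef m f = coef m g) : f = g :=
  Subtype.ext (MvPowerSeries.ext h)

theorem coef_mul (m : ℕ →₀ ℕ) (f g : RP K) :
    coef m (f * g) = ∑ p ∈ Finset.HasAntidiagonal.antidiagonal m, coef p.1 f * coef p.2 g :=
  MvPowerSeries.coeff_mul m _ _

theorem coef_mono_mul (u m : ℕ →₀ ℕ) (f : RP K) :
    coef m (mono K u * f) = if u ≤ m then coef (m - u) f else 0 := by
  have := MvPowerSeries.coeff_monomial_mul m u (f : MvPowerSeries ℕ K) 1
  rw [one_mul] at this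
  exact this

theorem coef_mono (u m : ℕ →₀ ℕ) [Decidable (m = u)] :
    coef m (mono K u) = if m = u then 1 else 0 := by
  classical
  refine (MvPowerSeries.coeff_monomial m u (1 : K)).trans ?_
  congr

theorem coef_smul (m : ℕ →₀ ℕ) (c : K) (f : RP K) : coef m (c • f) = c * coef m f := rfl

/-- All monomials occurring in `f` have total degree `D`. -/
def IsHomog (f : RP K) (D : ℕ) : Prop := ∀ m, coef m f ≠ 0 → m.degree = D

theorem IsInitial.unique (h : IsTermOrder lt) {f : RP K} {a b : ℕ →₀ ℕ} (ha : IsInitial lt f a)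
    (hb : IsInitial lt f b) : a = b := by
  rcases ha.2 b hb.1 with h1 | h1
  · exact h1.symm
  · rcases hb.2 a ha.1 with h2 | h2
    · exact h2
    · exact absurd h1 (h.asymm h2)

theorem IsInitial.mono_mul (h : IsTermOrder lt) {f : RP K} {a : ℕ →₀ ℕ} (ha : IsInitial lt f a)
    (u : ℕ →₀ ℕ) : IsInitial lt (mono K u * f) (u + a) := by
  constructor
  · change coef _ _ ≠ 0
    rw [coef_mono_mul, if_pos le_self_add, add_tsub_cancel_left]
    exact ha.1
  · intro m hm
    change coef _ _ ≠ 0 at hm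
    rw [coef_mono_mul] at hm
    split_ifs at hm with hle
    · rw [← add_tsub_cancel_of_le hle]
      rcases ha.2 _ hm with h1 | h1
      · exact Or.inl (by rw [h1])
      · exact Or.inr (h.add_left u h1)
    · exact absurd rfl hm

theorem exists_isInitial (h : IsTermOrder lt) {f : RP K} {D : ℕ} (hf : IsHomog f D)
    (hne : f ≠ 0) : ∃ m, IsInitial lt f m := by
  have hex : ∃ m, coef m f ≠ 0 := by
    by_contra hcon
    push Not at hcon
    exact hne (RP.ext fun m => by rw [hcon m]; rfl)
  obtain ⟨m, hm, hmin⟩ := h.wellFounded_gt.has_min {m | coef m f ≠ 0} hex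
  refine ⟨m, hm, fun m' hm' => ?_⟩
  rcases h.trichotomous m' m with h1 | h1 | h1
  · exact Or.inr h1
  · exact Or.inl h1
  · exact absurd ⟨h1, (hf m hm).trans (hf m' hm').symm⟩ (hmin m' hm')

open Classical in
/-- The initial monomial of `f` (and the monomial `1` if `f` has none). -/
def lead (lt : (ℕ →₀ ℕ) → (ℕ →₀ ℕ) → Prop) (f : RP K) : ℕ →₀ ℕ :=
  if h : ∃ m, IsInitial lt f m then h.choose else 0

theorem IsInitial.lead_eq (h : IsTermOrder lt) {f : RP K} {m : ℕ →₀ ℕ} (hm : IsInitial lt f m) :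
    lead lt f = m := by
  have hex : ∃ m, IsInitial lt f m := ⟨m, hm⟩
  rw [lead, dif_pos hex]
  exact hex.choose_spec.unique h hm

/-- The monomials that are initial monomials of elements of `I`. -/
def initialMonomials (lt : (ℕ →₀ ℕ) → (ℕ →₀ ℕ) → Prop) (I : Ideal (RP K)) : Set (ℕ →₀ ℕ) :=
  {m | ∃ f ∈ I, IsInitial lt f m}

theorem initialMonomials_mono (h : IsTermOrder lt) (I : Ideal (RP K)) {a b : ℕ →₀ ℕ}
    (hab : a ≤ b) (ha : a ∈ initialMonomials lt I) : b ∈ initialMonomials lt I := by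
  obtain ⟨f, hf, hin⟩ := ha
  refine ⟨mono K (b - a) * f, I.mul_mem_left _ hf, ?_⟩
  have := hin.mono_mul h (b - a)
  rwa [tsub_add_cancel_of_le hab] at this

/-- The initial ideal contains no monomials other than initial monomials of elements of `I`, since
these already form a monoid ideal. -/
theorem monomialsOf_initialIdeal (h : IsTermOrder lt) (I : Ideal (RP K)) :
    monomialsOf (initialIdeal lt I) = initialMonomials lt I := by
  classical
  ext m
  constructor
  · intro hm
    have key : ∀ g ∈ initialIdeal lt I, ∀ m, coef m g ≠ 0 → m ∈ initialMonomials lt I := by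
      intro g hg
      induction hg using Submodule.span_induction with
      | mem g hg =>
        obtain ⟨f, hf, u, hu, rfl⟩ := hg
        intro m hm
        rw [coef_mono] at hm
        split_ifs at hm with heq
        · exact heq ▸ ⟨f, hf, hu⟩
        · exact absurd rfl hm
      | zero => exact fun m hm => absurd rfl hm
      | add a b _ _ iha ihb =>
        intro m hm
        by_cases ha : coef m a = 0
        · refine ihb m fun hb => hm ?_
          change coef m a + coef m b = 0
          rw [ha, hb, add_zero]
        · exact iha m ha
      | smul a b _ ihb =>
        intro m hm
        rw [smul_eq_mul, coef_mul] at hm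
        obtain ⟨p, hp, hne⟩ := Finset.exists_ne_zero_of_sum_ne_zero hm
        rw [Finset.HasAntidiagonal.mem_antidiagonal] at hp
        exact initialMonomials_mono h I (hp ▸ le_add_self) (ihb p.2 (right_ne_zero_of_mul hne))
    refine key _ hm m ?_
    rw [coef_mono, if_pos rfl]
    exact one_ne_zero
  · rintro ⟨f, hf, hm⟩
    exact Ideal.subset_span ⟨f, hf, m, hm, rfl⟩

end Initial

/-! ### Division with remainder in the large polynomial ring -/

section Division

variable {K : Type*} [Field K] {lt : (ℕ →₀ ℕ) → (ℕ →₀ ℕ) → Prop}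

/-- `f` is a combination `∑ q_g g` of the elements of `G` in which every product of a monomial of
`q_g` with the initial monomial of `g` lies in `P`. For `P` the set of monomials smaller
than `μ` this is a standard representation of `f` below `μ`. -/
def Rep (lt : (ℕ →₀ ℕ) → (ℕ →₀ ℕ) → Prop) (G : Finset (RP K)) (P : Set (ℕ →₀ ℕ))
    (f : RP K) : Prop :=
  ∃ q : RP K → RP K, f = ∑ g ∈ G, q g * g ∧
    ∀ g ∈ G, ∀ u, coef u (q g) ≠ 0 → u + lead lt g ∈ P

/-- `g` is homogeneous, and its initial monomial has coefficient `1`. -/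
structure IsMonicHomog (lt : (ℕ →₀ ℕ) → (ℕ →₀ ℕ) → Prop) (g : RP K) : Prop where
  isInitial : IsInitial lt g (lead lt g)
  coef_lead : coef (lead lt g) g = 1
  isHomog : IsHomog g (lead lt g).degree

theorem Rep.zero (G : Finset (RP K)) (P : Set (ℕ →₀ ℕ)) : Rep lt G P 0 :=
  ⟨fun _ => 0, by simp, fun _ _ _ h => absurd rfl h⟩

theorem Rep.subset {G G' : Finset (RP K)} {P : Set (ℕ →₀ ℕ)} {f : RP K} (h : Rep lt G P f)
    (hG : G ⊆ G') : Rep lt G' P f := by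
  classical
  obtain ⟨q, hf, hq⟩ := h
  refine ⟨fun g => if g ∈ G then q g else 0, ?_, ?_⟩
  · rw [hf, ← Finset.sum_subset hG]
    · exact Finset.sum_congr rfl fun g hg => by dsimp only; rw [if_pos hg]
    · intro g _ hg
      dsimp only
      rw [if_neg hg, zero_mul]
  · intro g _ u hu
    dsimp only at hu
    by_cases hg : g ∈ G
    · rw [if_pos hg] at hu
      exact hq g hg u hu
    · rw [if_neg hg] at hu
      exact absurd rfl hu

theorem Rep.add {G : Finset (RP K)} {P : Set (ℕ →₀ ℕ)} {f f' : RP K} (h : Rep lt G P f)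
    (h' : Rep lt G P f') : Rep lt G P (f + f') := by
  obtain ⟨q, hf, hq⟩ := h
  obtain ⟨q', hf', hq'⟩ := h'
  refine ⟨fun g => q g + q' g, ?_, ?_⟩
  · rw [hf, hf', ← Finset.sum_add_distrib]
    exact Finset.sum_congr rfl fun g _ => (add_mul _ _ _).symm
  · intro g hg u hu
    by_cases h0 : coef u (q g) = 0
    · refine hq' g hg u fun h1 => hu ?_
      change coef u (q g) + coef u (q' g) = 0
      rw [h0, h1, add_zero]
    · exact hq g hg u h0

theorem Rep.smul_mem {G : Finset (RP K)} {P : Set (ℕ →₀ ℕ)} {g : RP K} (hg : g ∈ G) (c : K)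
    (hP : lead lt g ∈ P) : Rep lt G P (c • g) := by
  classical
  refine ⟨fun g' => if g' = g then c • (mono K 0) else 0, ?_, ?_⟩
  · rw [Finset.sum_eq_single g (fun b _ hb => by dsimp only; rw [if_neg hb, zero_mul])
      (fun h => absurd hg h)]
    dsimp only
    rw [if_pos rfl]
    refine RP.ext fun m => ?_
    rw [smul_mul_assoc, coef_smul, coef_smul, coef_mono_mul, if_pos zero_le, tsub_zero]
  · intro g' _ u hu
    dsimp only at hu
    split_ifs at hu with h
    · rw [coef_smul, coef_mono] at hu
      split_ifs at hu with h'
      · rw [h', h, zero_add]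
        exact hP
      · exact absurd (mul_zero c) hu
    · exact absurd rfl hu

theorem Rep.mem {G : Finset (RP K)} {P : Set (ℕ →₀ ℕ)} {f : RP K} (h : Rep lt G P f)
    {I : Ideal (RP K)} (hG : ∀ g ∈ G, g ∈ I) : f ∈ I := by
  obtain ⟨q, rfl, -⟩ := h
  exact I.sum_mem fun g hg => I.mul_mem_left _ (hG g hg)

/-- Division with remainder. The coefficient of the quotients and of the remainder that belongs
to the monomial `m` depends only on finitely many coefficients that belong to larger monomials of
the same degree, so that all of them can be computed by recursion along the term order. -/
theorem exists_remainder (h : IsTermOrder lt) {G : Finset (RP K)}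
    (hG : ∀ g ∈ G, IsMonicHomog lt g) {P : Set (ℕ →₀ ℕ)} {D : ℕ}
    (hPD : ∀ m ∈ P, m.degree = D) (hP : ∀ m ∈ P, ∀ m', m'.degree = D → lt m' m → m' ∈ P)
    {f : RP K} (hf : ∀ m, coef m f ≠ 0 → m ∈ P) :
    ∃ r : RP K, Rep lt G P (f - r) ∧ (∀ m, coef m r ≠ 0 → m ∈ P) ∧
      ∀ m, coef m r ≠ 0 → ∀ g ∈ G, ¬ lead lt g ≤ m := by
  classical
  -- `γ m` is the element of `G` that is used to cancel the monomial `m`.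
  have hγ : ∃ γ : (ℕ →₀ ℕ) → RP K, ∀ m, (∃ g ∈ G, lead lt g ≤ m) →
      γ m ∈ G ∧ lead lt (γ m) ≤ m := by
    refine ⟨fun m => if hm : ∃ g ∈ G, lead lt g ≤ m then hm.choose else 0, fun m hm => ?_⟩
    dsimp only
    rw [dif_pos hm]
    exact hm.choose_spec
  obtain ⟨γ, hγ⟩ := hγ
  -- `c m` is the coefficient of `m / lead (γ m)` in the quotient by `γ m`, or the coefficient
  -- of `m` in the remainder.
  have hc : ∃ c : (ℕ →₀ ℕ) → K, ∀ m, c m = coef m f -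
      ∑ g ∈ G, ∑ p ∈ Finset.HasAntidiagonal.antidiagonal m,
        if (lt m (p.1 + lead lt g) ∧ m.degree = (p.1 + lead lt g).degree) ∧
          γ (p.1 + lead lt g) = g then c (p.1 + lead lt g) * coef p.2 g else 0 := by
    refine ⟨h.wellFounded_gt.fix fun m c => coef m f -
      ∑ g ∈ G, ∑ p ∈ Finset.HasAntidiagonal.antidiagonal m,
        if H : (lt m (p.1 + lead lt g) ∧ m.degree = (p.1 + lead lt g).degree) ∧
          γ (p.1 + lead lt g) = g then c (p.1 + lead lt g) H.1 * coef p.2 g else 0,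
      fun m => ?_⟩
    rw [WellFounded.fix_eq]
    congr 1
  obtain ⟨c, hc⟩ := hc
  have hcP : ∀ m, c m ≠ 0 → m ∈ P := by
    intro m
    induction m using h.wellFounded_gt.induction with
    | h m ih =>
      intro hm
      by_cases hfm : coef m f = 0
      · rw [hc, hfm, zero_sub, neg_ne_zero] at hm
        obtain ⟨g, hg, hm⟩ := Finset.exists_ne_zero_of_sum_ne_zero hm
        obtain ⟨p, hp, hm⟩ := Finset.exists_ne_zero_of_sum_ne_zero hm
        split_ifs at hm with H
        · have := ih _ H.1 (left_ne_zero_of_mul hm)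
          exact hP _ this m (H.1.2.trans (hPD _ this)) H.1.1
        · exact absurd rfl hm
      · exact hf m hfm
  let q : RP K → RP K := fun g =>
    ⟨fun u => if γ (u + lead lt g) = g then c (u + lead lt g) else 0, D, fun u hu => by
      change (if γ (u + lead lt g) = g then c (u + lead lt g) else 0) ≠ 0 at hu
      split_ifs at hu with H
      · have := hPD _ (hcP _ hu)
        rw [map_add] at this
        omega
      · exact absurd rfl hu⟩
  have hq : ∀ g u, coef u (q g) = if γ (u + lead lt g) = g then c (u + lead lt g) else 0 :=
    fun _ _ => rfl
  let r : RP K := ⟨fun m => if ∃ g ∈ G, lead lt g ≤ m then 0 else c m, D, fun m hm => by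
      change (if ∃ g ∈ G, lead lt g ≤ m then 0 else c m) ≠ 0 at hm
      split_ifs at hm with H
      · exact absurd rfl hm
      · exact (hPD _ (hcP _ hm)).le⟩
  have hr : ∀ m, coef m r = if ∃ g ∈ G, lead lt g ≤ m then 0 else c m := fun _ => rfl
  refine ⟨r, ⟨q, ?_, ?_⟩, ?_, ?_⟩
  · rw [sub_eq_iff_eq_add]
    refine RP.ext fun m => ?_
    have hsum : coef m (∑ g ∈ G, q g * g + r) = (∑ g ∈ G, coef m (q g * g)) + coef m r := by
      change MvPowerSeries.coeff m ((∑ g ∈ G, q g * g : RP K) + r : MvPowerSeries ℕ K) = _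
      rw [AddSubmonoidClass.coe_finsetSum, map_add, map_sum]
    -- In `q g * g` the initial monomial of `g` contributes `c m` if `g` is used at `m`; the other
    -- monomials of `g` contribute exactly the terms that the recursion has subtracted.
    have hterm : ∀ g ∈ G, ∀ p ∈ Finset.HasAntidiagonal.antidiagonal m,
        coef p.1 (q g) * coef p.2 g = (if p.2 = lead lt g ∧ γ m = g then c m else 0) +
        if (lt m (p.1 + lead lt g) ∧ m.degree = (p.1 + lead lt g).degree) ∧
          γ (p.1 + lead lt g) = g then c (p.1 + lead lt g) * coef p.2 g else 0 := by
      intro g hg p hp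
      rw [Finset.HasAntidiagonal.mem_antidiagonal] at hp
      rw [hq]
      by_cases h2 : p.2 = lead lt g
      · have hm : p.1 + lead lt g = m := by rw [← h2, hp]
        rw [hm, h2, (hG g hg).coef_lead, if_neg (c := (lt m m ∧ m.degree = m.degree) ∧ γ m = g)
          (fun H => h.irrefl m H.1.1)]
        simp
      · rw [if_neg (c := p.2 = lead lt g ∧ γ m = g) (fun H => h2 H.1), zero_add]
        by_cases h0 : coef p.2 g = 0
        · simp [h0]
        · have hlt : lt p.2 (lead lt g) := ((hG g hg).isInitial.2 p.2 h0).resolve_left h2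
          have hlt' : lt m (p.1 + lead lt g) := hp ▸ h.add_left p.1 hlt
          have hd : m.degree = (p.1 + lead lt g).degree := by
            rw [← hp, map_add, map_add, (hG g hg).isHomog p.2 h0]
          simp only [hlt', ← hd, true_and, ite_mul, zero_mul]
    rw [hsum, hr]
    have h1 : ∑ g ∈ G, coef m (q g * g) =
        (∑ g ∈ G, ∑ p ∈ Finset.HasAntidiagonal.antidiagonal m,
          if p.2 = lead lt g ∧ γ m = g then c m else 0) +
        ∑ g ∈ G, ∑ p ∈ Finset.HasAntidiagonal.antidiagonal m,
          if (lt m (p.1 + lead lt g) ∧ m.degree = (p.1 + lead lt g).degree) ∧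
            γ (p.1 + lead lt g) = g then c (p.1 + lead lt g) * coef p.2 g else 0 := by
      rw [← Finset.sum_add_distrib]
      refine Finset.sum_congr rfl fun g hg => ?_
      rw [coef_mul, ← Finset.sum_add_distrib]
      exact Finset.sum_congr rfl fun p hp => hterm g hg p hp
    have h2 : (∑ g ∈ G, ∑ p ∈ Finset.HasAntidiagonal.antidiagonal m,
        if p.2 = lead lt g ∧ γ m = g then c m else 0) +
        (if ∃ g ∈ G, lead lt g ≤ m then 0 else c m) = c m := by
      by_cases H : ∃ g ∈ G, lead lt g ≤ m
      · obtain ⟨hγG, hγm⟩ := hγ m H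
        rw [if_pos H, add_zero, Finset.sum_eq_single (γ m)
          (fun g _ hg => Finset.sum_eq_zero fun p _ => if_neg fun H' => hg H'.2.symm)
          (fun H' => absurd hγG H'),
          Finset.sum_eq_single (m - lead lt (γ m), lead lt (γ m))]
        · simp
        · intro p hp hne
          rw [Finset.HasAntidiagonal.mem_antidiagonal] at hp
          refine if_neg fun H' => hne (Prod.ext ?_ H'.1)
          exact eq_tsub_of_add_eq (by rw [← H'.1, hp])
        · intro H'
          exact absurd (Finset.HasAntidiagonal.mem_antidiagonal.2 (tsub_add_cancel_of_le hγm)) H'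
      · rw [if_neg H, Finset.sum_eq_zero, zero_add]
        intro g hg
        refine Finset.sum_eq_zero fun p hp => if_neg fun H' => H ⟨g, hg, ?_⟩
        rw [Finset.HasAntidiagonal.mem_antidiagonal] at hp
        rw [← H'.1, ← hp]
        exact le_add_self
    rw [h1, add_right_comm, h2, hc m]
    ring
  · intro g hg u hu
    rw [hq] at hu
    split_ifs at hu with H
    · exact hcP _ hu
    · exact absurd rfl hu
  · intro m hm
    rw [hr] at hm
    split_ifs at hm with H
    · exact absurd rfl hm
    · exact hcP _ hm
  · intro m hm g hg hle
    rw [hr] at hm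
    split_ifs at hm with H
    · exact hm rfl
    · exact H ⟨g, hg, hle⟩

end Division

/-! ### Buchberger's algorithm, degree by degree -/

section Buchberger

variable {K : Type*} [Field K] {lt : (ℕ →₀ ℕ) → (ℕ →₀ ℕ) → Prop}

theorem eq_of_le_of_degree_le {σ : Type*} {a b : σ →₀ ℕ} (hab : a ≤ b)
    (hd : b.degree ≤ a.degree) : a = b := by
  have h1 : a + (b - a) = b := add_tsub_cancel_of_le hab
  have h2 := congrArg Finsupp.degree h1
  rw [map_add] at h2
  have h3 : b - a = 0 := (Finsupp.degree_eq_zero_iff _).1 (by omega)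
  rw [← h1, h3, add_zero]

/-- `P` is an initial segment of the monomials of degree `D` that contains the support of `f`. -/
structure IsSegment (lt : (ℕ →₀ ℕ) → (ℕ →₀ ℕ) → Prop) (D : ℕ) (f : RP K)
    (P : Set (ℕ →₀ ℕ)) : Prop where
  degree_eq : ∀ m ∈ P, m.degree = D
  mem_of_lt : ∀ m ∈ P, ∀ m', m'.degree = D → lt m' m → m' ∈ P
  support_subset : ∀ m, coef m f ≠ 0 → m ∈ P

theorem IsHomog.isSegment {f : RP K} {D : ℕ} (hf : IsHomog f D) :
    IsSegment lt D f {m | m.degree = D} :=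
  ⟨fun _ hm => hm, fun _ _ _ hm' _ => hm', hf⟩

/-- If `f` has a nonzero remainder modulo `G`, then it acquires a representation once the normalised
remainder is added to `G`. -/
theorem exists_insert_rep (h : IsTermOrder lt) {I : Ideal (RP K)} {G : Finset (RP K)}
    (hG : ∀ g ∈ G, g ∈ I ∧ IsMonicHomog lt g) {P : Set (ℕ →₀ ℕ)} {D : ℕ} {f : RP K}
    (hP : IsSegment lt D f P) (hf : f ∈ I) [DecidableEq (RP K)] :
    Rep lt G P f ∨ ∃ r ∈ I, IsMonicHomog lt r ∧ Rep lt (insert r G) P f ∧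
      (lead lt r).degree = D ∧ ∀ g ∈ G, ¬ lead lt g ≤ lead lt r := by
  obtain ⟨r, hrep, hrP, hrG⟩ := exists_remainder h (fun g hg => (hG g hg).2) hP.degree_eq
    hP.mem_of_lt hP.support_subset
  by_cases hr0 : r = 0
  · left
    rwa [hr0, sub_zero] at hrep
  right
  have hrhom : IsHomog r D := fun m hm => hP.degree_eq m (hrP m hm)
  obtain ⟨μ, hμ⟩ := exists_isInitial h hrhom hr0
  set a := coef μ r with ha
  have ha0 : a ≠ 0 := hμ.1
  -- The remainder is normalised to have leading coefficient `1`.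
  have hμ' : IsInitial lt (a⁻¹ • r) μ := by
    constructor
    · exact mul_ne_zero (inv_ne_zero ha0) ha0
    · exact fun m hm => hμ.2 m (right_ne_zero_of_mul hm)
  have hlead : lead lt (a⁻¹ • r) = μ := hμ'.lead_eq h
  have hrI : r ∈ I := by
    have := I.sub_mem hf (hrep.mem fun g hg => (hG g hg).1)
    rwa [sub_sub_cancel] at this
  refine ⟨a⁻¹ • r, ?_, ⟨hlead.symm ▸ hμ', ?_, ?_⟩, ?_, ?_, ?_⟩
  · exact Submodule.smul_of_tower_mem I a⁻¹ hrI
  · rw [hlead, coef_smul, ← ha, inv_mul_cancel₀ ha0]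
  · intro m hm
    rw [hlead, hrhom μ hμ.1]
    exact hrhom m (right_ne_zero_of_mul hm)
  · have h1 : f = (f - r) + a • (a⁻¹ • r) := by
      rw [smul_inv_smul₀ ha0, sub_add_cancel]
    rw [h1]
    exact (hrep.subset (Finset.subset_insert _ _)).add
      (Rep.smul_mem (Finset.mem_insert_self _ _) a (hlead.symm ▸ hrP μ hμ.1))
  · rw [hlead]
    exact hrhom μ hμ.1
  · rw [hlead]
    exact hrG μ hμ.1

/-- Finitely many elements of `I` of degree `D` acquire representations after finitely many
elements of degree `D` are added to `G`. The initial monomials added are not multiples of those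
already present, so that every pair involving a new element has its least common multiple in
degree greater than `D`. -/
theorem exists_superset_rep (h : IsTermOrder lt) {I : Ideal (RP K)} {G : Finset (RP K)}
    (hG : ∀ g ∈ G, g ∈ I ∧ IsMonicHomog lt g) {D : ℕ} (hD : ∀ g ∈ G, (lead lt g).degree ≤ D)
    (T : Finset (RP K × Set (ℕ →₀ ℕ)))
    (hT : ∀ t ∈ T, t.1 ∈ I ∧ IsSegment lt D t.1 t.2) :
    ∃ G' : Finset (RP K), G ⊆ G' ∧ (∀ g ∈ G', g ∈ I ∧ IsMonicHomog lt g) ∧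
      (∀ g ∈ G', (lead lt g).degree ≤ D) ∧ (∀ t ∈ T, Rep lt G' t.2 t.1) ∧
      ∀ g₁ ∈ G', ∀ g₂ ∈ G', g₁ ≠ g₂ → (lead lt g₁ ⊔ lead lt g₂).degree ≤ D → g₁ ∈ G ∧ g₂ ∈ G := by
  classical
  induction T using Finset.induction_on with
  | empty => exact ⟨G, subset_rfl, hG, hD, by simp, fun _ h1 _ h2 _ _ => ⟨h1, h2⟩⟩
  | insert t T _ ih =>
    obtain ⟨G₁, hGG, hG₁, hD₁, hT₁, hpair⟩ := ih fun t ht => hT t (Finset.mem_insert_of_mem ht)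
    obtain ⟨htI, htP⟩ := hT t (Finset.mem_insert_self t T)
    rcases exists_insert_rep h hG₁ htP htI with hrep | ⟨r, hrI, hrm, hrep, hrD, hrG⟩
    · refine ⟨G₁, hGG, hG₁, hD₁, ?_, hpair⟩
      intro s hs
      rcases Finset.mem_insert.1 hs with rfl | hs
      · exact hrep
      · exact hT₁ s hs
    · have hnew : ∀ g ∈ G₁, ¬ (lead lt g ⊔ lead lt r).degree ≤ D := by
        intro g hg hle
        have := eq_of_le_of_degree_le (le_sup_right (a := lead lt g) (b := lead lt r))
          (hle.trans hrD.ge)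
        exact hrG g hg (this ▸ le_sup_left)
      refine ⟨insert r G₁, hGG.trans (Finset.subset_insert _ _), ?_, ?_, ?_, ?_⟩
      · intro g hg
        rcases Finset.mem_insert.1 hg with rfl | hg
        · exact ⟨hrI, hrm⟩
        · exact hG₁ g hg
      · intro g hg
        rcases Finset.mem_insert.1 hg with rfl | hg
        · exact hrD.le
        · exact hD₁ g hg
      · intro s hs
        rcases Finset.mem_insert.1 hs with rfl | hs
        · exact hrep
        · exact (hT₁ s hs).subset (Finset.subset_insert _ _)
      · intro g₁ h₁ g₂ h₂ hne hle
        rcases Finset.mem_insert.1 h₁ with rfl | h₁' <;>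
          rcases Finset.mem_insert.1 h₂ with rfl | h₂'
        · exact absurd rfl hne
        · exact absurd (sup_comm (lead lt g₁) _ ▸ hle) (hnew g₂ h₂')
        · exact absurd hle (hnew g₁ h₁')
        · exact hpair g₁ h₁' g₂ h₂' hne hle

/-- The S-polynomial of two elements with leading coefficient `1`. -/
def sPoly (lt : (ℕ →₀ ℕ) → (ℕ →₀ ℕ) → Prop) (f g : RP K) : RP K :=
  mono K (lead lt f ⊔ lead lt g - lead lt f) * f - mono K (lead lt f ⊔ lead lt g - lead lt g) * g

/-- The monomials of the same degree as `μ` that are smaller than `μ`. -/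
def below (lt : (ℕ →₀ ℕ) → (ℕ →₀ ℕ) → Prop) (μ : ℕ →₀ ℕ) : Set (ℕ →₀ ℕ) :=
  {m | m.degree = μ.degree ∧ lt m μ}

theorem coef_sub (m : ℕ →₀ ℕ) (f g : RP K) : coef m (f - g) = coef m f - coef m g :=
  map_sub (MvPowerSeries.coeff m) _ _

theorem IsMonicHomog.coef_mono_mul {g : RP K} (hg : IsMonicHomog lt g) (u : ℕ →₀ ℕ) :
    coef (u + lead lt g) (mono K u * g) = 1 := by
  rw [LargePoly.coef_mono_mul, if_pos le_self_add, add_tsub_cancel_left, hg.coef_lead]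

theorem IsHomog.mono_mul {g : RP K} {D : ℕ} (hg : IsHomog g D) (u : ℕ →₀ ℕ) :
    IsHomog (mono K u * g) (u.degree + D) := by
  intro m hm
  rw [coef_mono_mul] at hm
  split_ifs at hm with hle
  · rw [← hg _ hm, ← map_add, add_tsub_cancel_of_le hle]
  · exact absurd rfl hm

/-- The leading terms of an S-polynomial cancel. -/
theorem isSegment_sPoly (h : IsTermOrder lt) {f g : RP K} (hf : IsMonicHomog lt f)
    (hg : IsMonicHomog lt g) : IsSegment lt (lead lt f ⊔ lead lt g).degree (sPoly lt f g)
      (below lt (lead lt f ⊔ lead lt g)) := by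
  refine ⟨fun m hm => hm.1, fun m hm m' hd hlt => ⟨hd, h.trans hlt hm.2⟩, fun m hm => ?_⟩
  have hf' : lead lt f ⊔ lead lt g - lead lt f + lead lt f = lead lt f ⊔ lead lt g :=
    tsub_add_cancel_of_le le_sup_left
  have hg' : lead lt f ⊔ lead lt g - lead lt g + lead lt g = lead lt f ⊔ lead lt g :=
    tsub_add_cancel_of_le le_sup_right
  have h1 := hf.isInitial.mono_mul h (lead lt f ⊔ lead lt g - lead lt f)
  have h2 := hg.isInitial.mono_mul h (lead lt f ⊔ lead lt g - lead lt g)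
  have h3 := hf.isHomog.mono_mul (lead lt f ⊔ lead lt g - lead lt f)
  have h4 := hg.isHomog.mono_mul (lead lt f ⊔ lead lt g - lead lt g)
  have h5 := hf.coef_mono_mul (lead lt f ⊔ lead lt g - lead lt f)
  have h6 := hg.coef_mono_mul (lead lt f ⊔ lead lt g - lead lt g)
  rw [hf'] at h1 h5
  rw [hg'] at h2 h6
  rw [← map_add, hf'] at h3
  rw [← map_add, hg'] at h4
  have hne : m ≠ lead lt f ⊔ lead lt g := by
    rintro rfl
    rw [sPoly, coef_sub, h5, h6, sub_self] at hm
    exact hm rfl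
  rw [sPoly, coef_sub] at hm
  by_cases h0 : coef m (mono K (lead lt f ⊔ lead lt g - lead lt f) * f) = 0
  · rw [h0, zero_sub, neg_ne_zero] at hm
    exact ⟨h4 m hm, (h2.2 m hm).resolve_left hne⟩
  · exact ⟨h3 m h0, (h1.2 m h0).resolve_left hne⟩

/-- A finite Gröbner basis in degrees less than `k`. -/
theorem exists_groebner (h : IsTermOrder lt) {F : ℕ → Set (RP K)} (hfin : ∀ d, (F d).Finite)
    (hF : ∀ d, ∀ f ∈ F d, IsHomog f d) (k : ℕ) :
    ∃ G : Finset (RP K), (∀ g ∈ G, g ∈ Ideal.span (⋃ d, F d) ∧ IsMonicHomog lt g) ∧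
      (∀ g ∈ G, (lead lt g).degree < k) ∧
      (∀ d < k, ∀ f ∈ F d, Rep lt G {m | m.degree = d} f) ∧
      ∀ g₁ ∈ G, ∀ g₂ ∈ G, (lead lt g₁ ⊔ lead lt g₂).degree < k →
        Rep lt G (below lt (lead lt g₁ ⊔ lead lt g₂)) (sPoly lt g₁ g₂) := by
  classical
  induction k with
  | zero => exact ⟨∅, by simp, by simp, by simp, by simp⟩
  | succ k ih =>
    obtain ⟨G, hG, hGk, hGF, hGS⟩ := ih
    -- The elements that need a representation in degree `k`: the given generators of degree `k`,
    -- and the S-polynomials whose least common multiple has degree `k`.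
    let T : Finset (RP K × Set (ℕ →₀ ℕ)) :=
      ((hfin k).toFinset.image fun f => (f, {m | m.degree = k})) ∪
      (((G ×ˢ G).filter fun p => (lead lt p.1 ⊔ lead lt p.2).degree = k).image fun p =>
        (sPoly lt p.1 p.2, below lt (lead lt p.1 ⊔ lead lt p.2)))
    have hT : ∀ t ∈ T, t.1 ∈ Ideal.span (⋃ d, F d) ∧ IsSegment lt k t.1 t.2 := by
      intro t ht
      rcases Finset.mem_union.1 ht with ht | ht
      · obtain ⟨f, hf, rfl⟩ := Finset.mem_image.1 ht
        rw [Set.Finite.mem_toFinset] at hf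
        exact ⟨Ideal.subset_span (Set.mem_iUnion.2 ⟨k, hf⟩), (hF k f hf).isSegment⟩
      · obtain ⟨p, hp, rfl⟩ := Finset.mem_image.1 ht
        obtain ⟨hp, hk⟩ := Finset.mem_filter.1 hp
        obtain ⟨hp1, hp2⟩ := Finset.mem_product.1 hp
        refine ⟨Ideal.sub_mem _ (Ideal.mul_mem_left _ _ (hG _ hp1).1)
          (Ideal.mul_mem_left _ _ (hG _ hp2).1), ?_⟩
        have := isSegment_sPoly h (hG _ hp1).2 (hG _ hp2).2
        rwa [hk] at this
    obtain ⟨G', hGG, hG', hD, hrep, hpair⟩ :=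
      exists_superset_rep h hG (fun g hg => (hGk g hg).le) T hT
    refine ⟨G', hG', fun g hg => Nat.lt_succ_of_le (hD g hg), ?_, ?_⟩
    · intro d hd f hf
      rcases (Nat.lt_succ_iff.1 hd).lt_or_eq with hd | rfl
      · exact (hGF d hd f hf).subset hGG
      · exact hrep (f, {m | m.degree = d}) (Finset.mem_union_left _
          (Finset.mem_image_of_mem _ ((hfin d).mem_toFinset.2 hf)))
    · intro g₁ h₁ g₂ h₂ hlt
      by_cases hne : g₁ = g₂
      · rw [hne, sPoly, sub_self]
        exact Rep.zero _ _
      · obtain ⟨h₁, h₂⟩ := hpair g₁ h₁ g₂ h₂ hne (Nat.lt_succ_iff.1 hlt)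
        rcases (Nat.lt_succ_iff.1 hlt).lt_or_eq with hd | hd
        · exact (hGS g₁ h₁ g₂ h₂ hd).subset hGG
        · exact hrep (sPoly lt g₁ g₂, below lt (lead lt g₁ ⊔ lead lt g₂))
            (Finset.mem_union_right _ (Finset.mem_image.2 ⟨(g₁, g₂), Finset.mem_filter.2
              ⟨Finset.mem_product.2 ⟨h₁, h₂⟩, hd⟩, rfl⟩))

end Buchberger

/-! ### Monomials in finitely many variables -/

/-- A monomial in the first `n` variables, as a monomial in all variables. -/
abbrev emb (n : ℕ) (m : Fin n →₀ ℕ) : ℕ →₀ ℕ := Finsupp.embDomain (Fin.valEmbedding (n := n)) m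

theorem emb_add {n : ℕ} (a b : Fin n →₀ ℕ) : emb n (a + b) = emb n a + emb n b :=
  Finsupp.embDomain_add _ a b

theorem emb_injective (n : ℕ) : Function.Injective (emb n) := Finsupp.embDomain_injective _

theorem emb_val {n : ℕ} (a : Fin n →₀ ℕ) (i : Fin n) : emb n a i = a i :=
  Finsupp.embDomain_apply_self _ a i

theorem emb_of_le {n : ℕ} (a : Fin n →₀ ℕ) {i : ℕ} (hi : n ≤ i) : emb n a i = 0 :=
  Finsupp.embDomain_of_notMem_range _ a i (by
    rintro ⟨j, rfl⟩
    exact absurd j.2 (not_lt.2 hi))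

theorem degree_emb {n : ℕ} (a : Fin n →₀ ℕ) : (emb n a).degree = a.degree := by
  rw [emb, Finsupp.embDomain_eq_mapDomain, Finsupp.degree_mapDomain]

theorem emb_le_emb {n : ℕ} {a b : Fin n →₀ ℕ} : emb n a ≤ emb n b ↔ a ≤ b := by
  constructor
  · intro h i
    rw [← emb_val a, ← emb_val b]
    exact h i
  · intro h i
    by_cases hi : i < n
    · exact ((emb_val a ⟨i, hi⟩).trans_le (h _)).trans_eq (emb_val b ⟨i, hi⟩).symm
    · rw [emb_of_le a (not_lt.1 hi)]
      exact zero_le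

theorem exists_emb_eq {n : ℕ} {m : ℕ →₀ ℕ} (hm : ∀ i, n ≤ i → m i = 0) : ∃ a, emb n a = m := by
  refine (Finsupp.mem_range_embDomain_iff _ m).2 fun i hi => ⟨⟨i, ?_⟩, rfl⟩
  by_contra hcon
  exact (Finsupp.mem_support_iff.1 hi) (hm i (not_lt.1 hcon))

theorem emb_sup {n : ℕ} (a b : Fin n →₀ ℕ) : emb n (a ⊔ b) = emb n a ⊔ emb n b := by
  ext i
  rw [Finsupp.sup_apply]
  by_cases hi : i < n
  · exact (emb_val _ ⟨i, hi⟩).trans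
      (congrArg₂ (· ⊔ ·) (emb_val a ⟨i, hi⟩).symm (emb_val b ⟨i, hi⟩).symm)
  · simp only [emb_of_le _ (not_lt.1 hi), sup_idem]

section Truncation

variable {K : Type*} [Field K]

theorem coeff_truncate {n : ℕ} (m : Fin n →₀ ℕ) (f : RP K) :
    MvPolynomial.coeff m (truncate K n f) = coef (emb n m) f := by
  have := congrArg (MvPowerSeries.coeff m) (coe_truncateFun n f)
  rw [MvPolynomial.coeff_coe, MvPowerSeries.coeff_killCompl] at this
  exact this

/-- A polynomial in the first `n` variables is the truncation of itself. -/
theorem truncate_surjective (n : ℕ) : Function.Surjective (truncate K n) := by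
  intro p
  refine ⟨⟨MvPolynomial.rename Fin.valEmbedding p, ?_⟩, ?_⟩
  · refine ⟨(MvPolynomial.rename (Fin.valEmbedding (n := n)) p).totalDegree, fun m hm => ?_⟩
    rw [MvPolynomial.coeff_coe] at hm
    have := MvPolynomial.le_totalDegree (MvPolynomial.mem_support_iff.2 hm)
    rwa [Finsupp.degree_apply]
  · ext m
    rw [coeff_truncate]
    change MvPowerSeries.coeff (emb n m) (MvPolynomial.rename (Fin.valEmbedding (n := n)) p :
      MvPowerSeries ℕ K) = _
    rw [MvPolynomial.coeff_coe, emb, Finsupp.embDomain_eq_mapDomain,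
      MvPolynomial.coeff_rename_mapDomain _ Fin.valEmbedding.injective]

theorem mem_map_truncate {n : ℕ} {I : Ideal (RP K)} {f : MvPolynomial (Fin n) K} :
    f ∈ I.map (truncate K n) ↔ ∃ F ∈ I, truncate K n F = f :=
  Ideal.mem_map_iff_of_surjective _ (truncate_surjective n)

theorem truncate_mono_emb {n : ℕ} (m : Fin n →₀ ℕ) :
    truncate K n (mono K (emb n m)) = MvPolynomial.monomial m 1 := by
  classical
  ext a
  rw [coeff_truncate, coef_mono, MvPolynomial.coeff_monomial]
  simp only [(emb_injective n).eq_iff, eq_comm]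

/-- `m` is the largest monomial of the polynomial `f` in the first `n` variables. -/
def IsInitialFin (lt : (ℕ →₀ ℕ) → (ℕ →₀ ℕ) → Prop) {n : ℕ} (f : MvPolynomial (Fin n) K)
    (m : Fin n →₀ ℕ) : Prop :=
  f.coeff m ≠ 0 ∧ ∀ m', f.coeff m' ≠ 0 → m' = m ∨ lt (emb n m') (emb n m)

/-- The initial monomials of the elements of an ideal of `K[x_0, …, x_{n-1}]`. -/
def initialMonomialsFin (lt : (ℕ →₀ ℕ) → (ℕ →₀ ℕ) → Prop) {n : ℕ}
    (J : Ideal (MvPolynomial (Fin n) K)) : Set (Fin n →₀ ℕ) :=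
  {m | ∃ f ∈ J, IsInitialFin lt f m}

variable {lt : (ℕ →₀ ℕ) → (ℕ →₀ ℕ) → Prop}

theorem IsInitialFin.unique (h : IsTermOrder lt) {n : ℕ} {f : MvPolynomial (Fin n) K}
    {a b : Fin n →₀ ℕ} (ha : IsInitialFin lt f a) (hb : IsInitialFin lt f b) : a = b := by
  rcases ha.2 b hb.1 with h1 | h1
  · exact h1.symm
  · rcases hb.2 a ha.1 with h2 | h2
    · exact h2
    · exact absurd h1 (h.asymm h2)

theorem IsInitialFin.monomial_mul (h : IsTermOrder lt) {n : ℕ} {f : MvPolynomial (Fin n) K}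
    {a : Fin n →₀ ℕ} (ha : IsInitialFin lt f a) (u : Fin n →₀ ℕ) :
    IsInitialFin lt (MvPolynomial.monomial u 1 * f) (u + a) := by
  constructor
  · rw [MvPolynomial.coeff_monomial_mul, one_mul]
    exact ha.1
  · intro m hm
    rw [MvPolynomial.coeff_monomial_mul'] at hm
    split_ifs at hm with hle
    · rw [one_mul] at hm
      rw [← add_tsub_cancel_of_le hle]
      rcases ha.2 _ hm with h1 | h1
      · exact Or.inl (by rw [h1])
      · refine Or.inr ?_
        rw [emb_add, emb_add]
        exact h.add_left _ h1
    · exact absurd rfl hm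

theorem initialMonomialsFin_mono (h : IsTermOrder lt) {n : ℕ}
    (J : Ideal (MvPolynomial (Fin n) K)) {a b : Fin n →₀ ℕ} (hab : a ≤ b)
    (ha : a ∈ initialMonomialsFin lt J) : b ∈ initialMonomialsFin lt J := by
  obtain ⟨f, hf, hin⟩ := ha
  refine ⟨MvPolynomial.monomial (b - a) 1 * f, J.mul_mem_left _ hf, ?_⟩
  have := hin.monomial_mul h (b - a)
  rwa [tsub_add_cancel_of_le hab] at this

theorem IsInitial.truncate {n : ℕ} {f : RP K} {m : Fin n →₀ ℕ} (hm : IsInitial lt f (emb n m)) :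
    IsInitialFin lt (truncate K n f) m := by
  constructor
  · rw [coeff_truncate]
    exact hm.1
  · intro m' hm'
    rw [coeff_truncate] at hm'
    rcases hm.2 _ hm' with h1 | h1
    · exact Or.inl (emb_injective n h1)
    · exact Or.inr h1

theorem mem_initialMonomialsFin_of_emb_mem {n : ℕ} {I : Ideal (RP K)} {m : Fin n →₀ ℕ}
    (hm : emb n m ∈ initialMonomials lt I) :
    m ∈ initialMonomialsFin lt (I.map (truncate K n)) := by
  obtain ⟨f, hf, hin⟩ := hm
  exact ⟨truncate K n f, Ideal.mem_map_of_mem _ hf, hin.truncate⟩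

end Truncation

/-! ### Buchberger's criterion in finitely many variables -/

section Criterion

variable {K : Type*} [Field K] {lt : (ℕ →₀ ℕ) → (ℕ →₀ ℕ) → Prop} {n : ℕ} {ι : Type*}

/-- The span of all multiples `x^u p_i` whose formal initial monomial `x^u l_i` lies in `P`. -/
def multiples (p : ι → MvPolynomial (Fin n) K) (l : ι → Fin n →₀ ℕ) (P : Set (Fin n →₀ ℕ)) :
    Submodule K (MvPolynomial (Fin n) K) :=
  Submodule.span K {f | ∃ i u, u + l i ∈ P ∧ f = MvPolynomial.monomial u 1 * p i}

/-- The monomials of the same degree as `μ` that are smaller than `μ`. -/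
def belowFin (lt : (ℕ →₀ ℕ) → (ℕ →₀ ℕ) → Prop) (μ : Fin n →₀ ℕ) : Set (Fin n →₀ ℕ) :=
  {m | m.degree = μ.degree ∧ lt (emb n m) (emb n μ)}

variable {p : ι → MvPolynomial (Fin n) K} {l : ι → Fin n →₀ ℕ}

theorem multiples_mul_mem {P P' : Set (Fin n →₀ ℕ)} {w : Fin n →₀ ℕ}
    (hw : ∀ m ∈ P, w + m ∈ P') {f : MvPolynomial (Fin n) K} (hf : f ∈ multiples p l P) :
    MvPolynomial.monomial w 1 * f ∈ multiples p l P' := by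
  rw [multiples] at hf
  induction hf using Submodule.span_induction with
  | mem f hf =>
    obtain ⟨i, u, hu, rfl⟩ := hf
    refine Submodule.subset_span ⟨i, w + u, ?_, ?_⟩
    · rw [add_assoc]
      exact hw _ hu
    · rw [← mul_assoc, MvPolynomial.monomial_mul, one_mul]
  | zero => simp
  | add a b _ _ ha hb =>
    rw [mul_add]
    exact add_mem ha hb
  | smul c a _ ha =>
    rw [mul_smul_comm]
    exact Submodule.smul_mem _ c ha

theorem mul_mem_multiples {P : Set (Fin n →₀ ℕ)} {q : MvPolynomial (Fin n) K} {i : ι}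
    (hq : ∀ u, q.coeff u ≠ 0 → u + l i ∈ P) : q * p i ∈ multiples p l P := by
  rw [q.as_sum, Finset.sum_mul]
  refine sum_mem fun u hu => ?_
  have : MvPolynomial.monomial u (q.coeff u) = q.coeff u • MvPolynomial.monomial u (1 : K) := by
    rw [MvPolynomial.smul_monomial, smul_eq_mul, mul_one]
  rw [this, smul_mul_assoc]
  exact Submodule.smul_mem _ _ (Submodule.subset_span
    ⟨i, u, hq u (MvPolynomial.mem_support_iff.1 hu), rfl⟩)

theorem coeff_eq_zero_of_mem_multiples (h : IsTermOrder lt) (hp : ∀ i, IsInitialFin lt (p i) (l i))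
    {P : Set (Fin n →₀ ℕ)} {ν : Fin n →₀ ℕ} (hP : ∀ m ∈ P, lt (emb n m) (emb n ν))
    {f : MvPolynomial (Fin n) K} (hf : f ∈ multiples p l P) (m : Fin n →₀ ℕ)
    (hm : ¬ lt (emb n m) (emb n ν)) : f.coeff m = 0 := by
  rw [multiples] at hf
  induction hf using Submodule.span_induction with
  | mem f hf =>
    obtain ⟨i, u, hu, rfl⟩ := hf
    by_contra hne
    rcases ((hp i).monomial_mul h u).2 m hne with h1 | h1
    · exact hm (h1 ▸ hP _ hu)
    · exact hm (h.trans h1 (hP _ hu))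
  | zero => simp
  | add a b _ _ ha hb => rw [MvPolynomial.coeff_add, ha, hb, add_zero]
  | smul c a _ ha => rw [MvPolynomial.coeff_smul, ha, smul_zero]

theorem exists_greatest (h : IsTermOrder lt) {P : Set (Fin n →₀ ℕ)} {e : ℕ}
    (he : ∀ m ∈ P, m.degree = e) (hne : P.Nonempty) :
    ∃ ν ∈ P, ∀ m ∈ P, m = ν ∨ m ∈ belowFin lt ν := by
  obtain ⟨_, ⟨ν, hν, rfl⟩, hmin⟩ := h.wellFounded_gt.has_min (emb n '' P) (hne.image _)
  refine ⟨ν, hν, fun m hm => ?_⟩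
  have hd : m.degree = ν.degree := (he m hm).trans (he ν hν).symm
  rcases h.trichotomous (emb n m) (emb n ν) with h1 | h1 | h1
  · exact Or.inr ⟨hd, h1⟩
  · exact Or.inl (emb_injective n h1)
  · exact absurd ⟨h1, by rw [degree_emb, degree_emb, hd]⟩ (hmin _ ⟨m, hm, rfl⟩)

/-- Buchberger's criterion, in degree `e`. If all S-polynomials of degree at most `e` have
representations below the least common multiple, then a combination of multiples of the `p_i` can
be rewritten until its formal initial monomial is its actual one. -/
theorem exists_isInitialFin_of_mem_multiples (h : IsTermOrder lt)
    (hp : ∀ i, IsInitialFin lt (p i) (l i)) (hcoeff : ∀ i, (p i).coeff (l i) = 1) {e : ℕ}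
    (hS : ∀ i j, (l i ⊔ l j).degree ≤ e →
      MvPolynomial.monomial (l i ⊔ l j - l i) 1 * p i -
        MvPolynomial.monomial (l i ⊔ l j - l j) 1 * p j ∈ multiples p l (belowFin lt (l i ⊔ l j)))
    {P : Set (Fin n →₀ ℕ)} (he : ∀ m ∈ P, m.degree = e)
    (hP : ∀ m ∈ P, belowFin lt m ⊆ P) {f : MvPolynomial (Fin n) K}
    (hf : f ∈ multiples p l P) (hf0 : f ≠ 0) :
    ∃ m i, IsInitialFin lt f m ∧ l i ≤ m := by
  have hfin : ∀ Q : Set (Fin n →₀ ℕ), (∀ m ∈ Q, m.degree = e) → Q.Finite := fun Q hQ =>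
    (Finsupp.finite_of_degree_le (σ := Fin n) e).subset fun m hm => (hQ m hm).le
  -- Induction on the size of `P`: if the coefficient of the greatest element of `P` is zero, it can
  -- be dropped from `P`.
  induction hk : P.ncard using Nat.strong_induction_on generalizing P f with
  | h k ih =>
    rcases P.eq_empty_or_nonempty with rfl | hne
    · exfalso
      rw [multiples] at hf
      simp only [Set.mem_empty_iff_false, false_and, exists_false] at hf
      exact hf0 (by simpa using hf)
    obtain ⟨ν, hν, hmax⟩ := exists_greatest h he hne
    have hνe := he ν hν
    have hsub : belowFin lt ν ⊂ P :=
      ⟨hP ν hν, fun hcon => h.irrefl _ (hcon hν).2⟩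
    have hbelow : ∀ f ∈ multiples p l (belowFin lt ν), f ≠ 0 →
        ∃ m i, IsInitialFin lt f m ∧ l i ≤ m := by
      intro f hf hf0
      refine ih _ (hk ▸ Set.ncard_lt_ncard hsub (hfin P he)) (fun m hm => hm.1.trans hνe) ?_
        hf hf0 rfl
      exact fun m hm m' hm' => ⟨hm'.1.trans hm.1, h.trans hm'.2 hm.2⟩
    by_cases hdiv : ∃ i, l i ≤ ν
    · obtain ⟨i₀, hi₀⟩ := hdiv
      set b := MvPolynomial.monomial (ν - l i₀) 1 * p i₀ with hb
      -- Modulo the multiples below `ν`, all multiples with formal initial monomial `ν` agree.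
      have hle : multiples p l P ≤ K ∙ b ⊔ multiples p l (belowFin lt ν) := by
        refine Submodule.span_le.2 ?_
        rintro _ ⟨i, u, hu, rfl⟩
        rcases hmax _ hu with heq | hlt
        · have hlcm : l i ⊔ l i₀ ≤ ν := sup_le (heq ▸ le_add_self) hi₀
          have hdeg : (l i ⊔ l i₀).degree ≤ e := by
            have := congrArg Finsupp.degree (add_tsub_cancel_of_le hlcm)
            rw [map_add, hνe] at this
            omega
          have hw : ∀ m ∈ belowFin lt (l i ⊔ l i₀),
              (ν - (l i ⊔ l i₀)) + m ∈ belowFin lt ν := by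
            intro m hm
            have hν' : ν = (ν - (l i ⊔ l i₀)) + (l i ⊔ l i₀) := (tsub_add_cancel_of_le hlcm).symm
            constructor
            · conv_rhs => rw [hν']
              rw [map_add, map_add, hm.1]
            · conv_rhs => rw [hν']
              rw [emb_add, emb_add]
              exact h.add_left _ hm.2
          have hmem := multiples_mul_mem hw (hS i i₀ hdeg)
          rw [mul_sub, ← mul_assoc, ← mul_assoc, MvPolynomial.monomial_mul,
            MvPolynomial.monomial_mul, one_mul, tsub_add_tsub_cancel hlcm le_sup_left,
            tsub_add_tsub_cancel hlcm le_sup_right, ← hb, ← heq, add_tsub_cancel_right, heq] at hmem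
          rw [← sub_add_cancel (MvPolynomial.monomial u 1 * p i) b, add_comm]
          exact Submodule.add_mem_sup (Submodule.mem_span_singleton_self b) hmem
        · exact Submodule.mem_sup_right (Submodule.subset_span ⟨i, u, hlt, rfl⟩)
      obtain ⟨c, v, hv, rfl⟩ : ∃ (c : K), ∃ v ∈ multiples p l (belowFin lt ν), c • b + v = f := by
        obtain ⟨a, ha, v, hv, hav⟩ := Submodule.mem_sup.1 (hle hf)
        obtain ⟨c, rfl⟩ := Submodule.mem_span_singleton.1 ha
        exact ⟨c, v, hv, hav⟩
      by_cases hc : c = 0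
      · rw [hc, zero_smul, zero_add] at hf0 ⊢
        exact hbelow v hv hf0
      · have hbin : IsInitialFin lt b ν := by
          have := (hp i₀).monomial_mul h (ν - l i₀)
          rwa [tsub_add_cancel_of_le hi₀] at this
        have hb1 : b.coeff ν = 1 := by
          conv_lhs => rw [← tsub_add_cancel_of_le hi₀]
          rw [hb, MvPolynomial.coeff_monomial_mul, one_mul, hcoeff]
        have hv0 := coeff_eq_zero_of_mem_multiples h hp (fun m hm => hm.2) hv
        refine ⟨ν, i₀, ⟨?_, fun m hm => ?_⟩, hi₀⟩
        · rw [MvPolynomial.coeff_add, MvPolynomial.coeff_smul, hb1, hv0 ν (h.irrefl _)]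
          simpa using hc
        · by_contra hcon
          push Not at hcon
          refine hm ?_
          rw [MvPolynomial.coeff_add, MvPolynomial.coeff_smul, hv0 m hcon.2, add_zero]
          by_cases hbm : b.coeff m = 0
          · rw [hbm, smul_zero]
          · rcases hbin.2 m hbm with h1 | h1
            · exact absurd h1 hcon.1
            · exact absurd h1 hcon.2
    · refine hbelow f ?_ hf0
      refine Submodule.span_mono ?_ hf
      rintro _ ⟨i, u, hu, rfl⟩
      refine ⟨i, u, (hmax _ hu).resolve_left fun heq => hdiv ⟨i, ?_⟩, rfl⟩
      exact heq ▸ le_add_self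

end Criterion

/-! ### Initial monomials of the truncated ideals -/

section Stabilization

variable {K : Type*} [Field K] {lt : (ℕ →₀ ℕ) → (ℕ →₀ ℕ) → Prop}

theorem Rep.truncate_mem {G : Finset (RP K)} {P : Set (ℕ →₀ ℕ)} {f : RP K} (hf : Rep lt G P f)
    {n : ℕ} {l : G → Fin n →₀ ℕ} (hl : ∀ g : G, emb n (l g) = lead lt (g : RP K)) :
    truncate K n f ∈ multiples (fun g : G => truncate K n g) l {m | emb n m ∈ P} := by
  obtain ⟨q, rfl, hq⟩ := hf
  rw [map_sum]
  refine sum_mem fun g hg => ?_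
  rw [map_mul]
  refine mul_mem_multiples (p := fun g : G => truncate K n g) (i := ⟨g, hg⟩) fun u hu => ?_
  rw [coeff_truncate] at hu
  change emb n _ ∈ P
  rw [emb_add, hl]
  exact hq g hg _ hu

/-- An element of the truncated ideal has the components of low degree in the span of the
multiples of the truncated Gröbner basis. -/
theorem homogeneousComponent_truncate_mem {F : ℕ → Set (RP K)}
    (hF : ∀ d, ∀ f ∈ F d, IsHomog f d) {n : ℕ} {ι : Type*} {p : ι → MvPolynomial (Fin n) K}
    {l : ι → Fin n →₀ ℕ} {d : ℕ}
    (hFm : ∀ e ≤ d, ∀ f ∈ F e, truncate K n f ∈ multiples p l {m | m.degree = e})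
    {f : RP K} (hf : f ∈ Ideal.span (⋃ d, F d)) {e : ℕ} (he : e ≤ d) :
    MvPolynomial.homogeneousComponent e (truncate K n f) ∈
      multiples p l {m | m.degree = e} := by
  rw [Ideal.span] at hf
  induction hf using Submodule.closure_induction with
  | zero => simp
  | add a b _ _ ha hb =>
    rw [map_add, map_add]
    exact add_mem ha hb
  | smul_mem a s hs =>
    obtain ⟨j, hj⟩ := Set.mem_iUnion.1 hs
    rw [smul_eq_mul, map_mul, (truncate K n a).as_sum, Finset.sum_mul, map_sum]
    refine sum_mem fun u _ => ?_
    have hone : MvPolynomial.monomial u ((truncate K n a).coeff u) =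
        (truncate K n a).coeff u • MvPolynomial.monomial u (1 : K) := by
      rw [MvPolynomial.smul_monomial, smul_eq_mul, mul_one]
    rw [hone, smul_mul_assoc, map_smul]
    refine Submodule.smul_mem _ _ ?_
    have hs' : (truncate K n s).IsHomogeneous j := by
      intro m hm
      rw [coeff_truncate] at hm
      have := hF j s hj _ hm
      rwa [degree_emb, Finsupp.degree_eq_weight_one] at this
    have hhom := (MvPolynomial.isHomogeneous_monomial (1 : K) (rfl : u.degree = _)).mul hs'
    rw [MvPolynomial.homogeneousComponent_of_mem hhom]
    split_ifs with heq
    · subst heq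
      refine multiples_mul_mem ?_ (hFm j (by omega) s hj)
      intro m hm
      have hm' : m.degree = j := hm
      change (u + m).degree = _
      rw [map_add, hm']
    · exact zero_mem _

/-- In degrees at most `d`, the initial monomials of `I`, and those of all truncations of `I` to
sufficiently many variables, are the multiples of one and the same finite set of monomials. -/
theorem exists_common_generators (h : IsTermOrder lt) {I : Ideal (RP K)} (hI : IsLFG I) (d : ℕ) :
    ∃ (B : Finset (ℕ →₀ ℕ)) (N : ℕ), (∀ b ∈ B, ∀ i, N ≤ i → b i = 0) ∧
      (∀ n ≥ N, ∀ m : Fin n →₀ ℕ, m.degree ≤ d →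
        (m ∈ initialMonomialsFin lt (I.map (truncate K n)) ↔ ∃ b ∈ B, b ≤ emb n m)) ∧
      ∀ m : ℕ →₀ ℕ, m.degree ≤ d → (m ∈ initialMonomials lt I ↔ ∃ b ∈ B, b ≤ m) := by
  classical
  obtain ⟨F, hfin, hF, rfl⟩ := hI
  set I := Ideal.span (⋃ d, F d) with hIdef
  obtain ⟨G, hG, hGd, hGF, hGS⟩ := exists_groebner h hfin hF (d + 1)
  have hGI : ∀ g ∈ G, lead lt g ∈ initialMonomials lt I := fun g hg =>
    ⟨g, (hG g hg).1, (hG g hg).2.isInitial⟩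
  obtain ⟨N, hN⟩ : ∃ N, ∀ g ∈ G, ∀ i, N ≤ i → lead lt g i = 0 := by
    refine ⟨(G.biUnion fun g => (lead lt g).support).sup id + 1, fun g hg i hi => ?_⟩
    by_contra hne
    have : i ≤ (G.biUnion fun g => (lead lt g).support).sup id :=
      Finset.le_sup (f := id) (Finset.mem_biUnion.2 ⟨g, hg, Finsupp.mem_support_iff.2 hne⟩)
    omega
  have hfinite : ∀ n ≥ N, ∀ m : Fin n →₀ ℕ, m.degree ≤ d →
      (m ∈ initialMonomialsFin lt (I.map (truncate K n)) ↔
        ∃ b ∈ G.image (lead lt), b ≤ emb n m) := by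
    intro n hn m hm
    constructor
    · rintro ⟨_, hmap, hin⟩
      obtain ⟨f, hf, rfl⟩ := mem_map_truncate.1 hmap
      have hl : ∀ g : G, ∃ a, emb n a = lead lt (g : RP K) := fun g =>
        exists_emb_eq fun i hi => hN g g.2 i (hn.trans hi)
      choose l hl using hl
      let p : G → MvPolynomial (Fin n) K := fun g => truncate K n g
      have hp : ∀ g, IsInitialFin lt (p g) (l g) := fun g => by
        refine IsInitial.truncate ?_
        rw [hl]
        exact (hG g g.2).2.isInitial
      have hcoeff : ∀ g, (p g).coeff (l g) = 1 := fun g => by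
        rw [coeff_truncate, hl]
        exact (hG g g.2).2.coef_lead
      have hS : ∀ i j, (l i ⊔ l j).degree ≤ m.degree →
          MvPolynomial.monomial (l i ⊔ l j - l i) 1 * p i -
            MvPolynomial.monomial (l i ⊔ l j - l j) 1 * p j ∈
              multiples p l (belowFin lt (l i ⊔ l j)) := by
        intro i j hij
        have hsup : emb n (l i ⊔ l j) = lead lt (i : RP K) ⊔ lead lt (j : RP K) := by
          rw [emb_sup, hl, hl]
        have htsub : ∀ k : G, l k ≤ l i ⊔ l j →
            emb n (l i ⊔ l j - l k) = emb n (l i ⊔ l j) - lead lt (k : RP K) := by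
          intro k hk
          refine eq_tsub_of_add_eq ?_
          rw [← hl, ← emb_add, tsub_add_cancel_of_le hk]
        have hrep := hGS i i.2 j j.2 (by
          rw [← hsup, degree_emb]
          omega)
        have hmem := hrep.truncate_mem hl
        have hpoly : truncate K n (sPoly lt (i : RP K) j) =
            MvPolynomial.monomial (l i ⊔ l j - l i) 1 * p i -
            MvPolynomial.monomial (l i ⊔ l j - l j) 1 * p j := by
          rw [sPoly, map_sub, map_mul, map_mul, ← hsup, ← htsub i le_sup_left,
            ← htsub j le_sup_right, truncate_mono_emb, truncate_mono_emb]
        rw [hpoly] at hmem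
        refine Submodule.span_mono ?_ hmem
        rintro _ ⟨k, u, hu, rfl⟩
        refine ⟨k, u, ?_, rfl⟩
        have hu' : emb n (u + l k) ∈ below lt (lead lt (i : RP K) ⊔ lead lt (j : RP K)) := hu
        rw [← hsup] at hu'
        exact ⟨by rw [← degree_emb, hu'.1, degree_emb], hu'.2⟩
      have hFm : ∀ e ≤ d, ∀ f ∈ F e, truncate K n f ∈ multiples p l {m | m.degree = e} := by
        intro e he f hf
        have hmem := (hGF e (by omega) f hf).truncate_mem hl
        refine Submodule.span_mono ?_ hmem
        rintro _ ⟨k, u, hu, rfl⟩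
        exact ⟨k, u, (degree_emb _).symm.trans hu, rfl⟩
      have hcomp := homogeneousComponent_truncate_mem hF hFm hf hm
      have hin' : IsInitialFin lt (MvPolynomial.homogeneousComponent m.degree (truncate K n f))
          m := by
        constructor
        · rw [MvPolynomial.coeff_homogeneousComponent, if_pos rfl]
          exact hin.1
        · intro m' hm'
          rw [MvPolynomial.coeff_homogeneousComponent] at hm'
          split_ifs at hm' with hd
          · exact hin.2 m' hm'
          · exact absurd rfl hm'
      obtain ⟨m', g, hm', hg⟩ := exists_isInitialFin_of_mem_multiples h hp hcoeff hS
        (P := {a | a.degree = m.degree}) (fun a ha => ha)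
        (fun a ha b hb => hb.1.trans ha) hcomp (by
          intro h0
          exact hin'.1 (by rw [h0, MvPolynomial.coeff_zero]))
      have hmm : m' = m := hm'.unique h hin'
      refine ⟨lead lt (g : RP K), Finset.mem_image_of_mem _ g.2, ?_⟩
      rw [← hl, emb_le_emb, ← hmm]
      exact hg
    · rintro ⟨b, hb, hle⟩
      obtain ⟨g, hg, rfl⟩ := Finset.mem_image.1 hb
      exact mem_initialMonomialsFin_of_emb_mem (initialMonomials_mono h I hle (hGI g hg))
  refine ⟨G.image (lead lt), N, ?_, hfinite, ?_⟩
  · intro b hb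
    obtain ⟨g, hg, rfl⟩ := Finset.mem_image.1 hb
    exact hN g hg
  · intro m hm
    constructor
    · -- An initial monomial of `f` survives the truncation to sufficiently many variables.
      intro hmem
      obtain ⟨a, ha⟩ : ∃ a, emb (N + m.support.sup id + 1) a = m := by
        refine exists_emb_eq fun i hi => ?_
        by_contra hne
        have : i ≤ m.support.sup id := Finset.le_sup (f := id) (Finsupp.mem_support_iff.2 hne)
        omega
      rw [← ha] at hmem hm ⊢
      rw [degree_emb] at hm
      exact (hfinite _ (by omega) a hm).1 (mem_initialMonomialsFin_of_emb_mem hmem)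
    · rintro ⟨b, hb, hle⟩
      obtain ⟨g, hg, rfl⟩ := Finset.mem_image.1 hb
      exact initialMonomials_mono h I hle (hGI g hg)

end Stabilization

/-! ### Numerators of monomial ideals -/

theorem coeff_moebius_mul_hilbert (M : Set (ℕ →₀ ℕ)) (m : ℕ →₀ ℕ) :
    MvPowerSeries.coeff m (moebiusX * hilbertX M) =
      ∑ p ∈ Finset.HasAntidiagonal.antidiagonal m, MvPowerSeries.coeff p.1 moebiusX *
        MvPowerSeries.coeff p.2 (hilbertX M) :=
  MvPowerSeries.coeff_mul m _ _

open Classical in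
theorem coeff_moebiusX (m : ℕ →₀ ℕ) :
    MvPowerSeries.coeff m moebiusX = if ∀ i, m i ≤ 1 then (-1) ^ m.degree else 0 := rfl

open Classical in
theorem coeff_hilbertX (M : Set (ℕ →₀ ℕ)) (m : ℕ →₀ ℕ) :
    MvPowerSeries.coeff m (hilbertX M) = if m ∈ M then 0 else 1 := rfl

theorem coeff_moebiusX_add_single {s : ℕ →₀ ℕ} {i : ℕ} (hs : s i = 0) :
    MvPowerSeries.coeff (s + Finsupp.single i 1) moebiusX = -MvPowerSeries.coeff s moebiusX := by
  classical
  rw [coeff_moebiusX, coeff_moebiusX, map_add, Finsupp.degree_single, pow_succ]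
  have hiff : (∀ j, (s + Finsupp.single i 1 : ℕ →₀ ℕ) j ≤ 1) ↔ ∀ j, s j ≤ 1 := by
    refine forall_congr' fun j => ?_
    rw [Finsupp.add_apply]
    by_cases hj : i = j
    · subst hj
      rw [hs, Finsupp.single_eq_same]
      omega
    · rw [Finsupp.single_apply, if_neg hj, add_zero]
  simp only [hiff]
  split_ifs <;> simp

/-- If membership of a monomial in `M` does not change when its exponent of `x_i` drops from `m i`
to `m i - 1`, then the terms of the numerator at `m` cancel in pairs. -/
theorem coeff_numerator_eq_zero {M : Set (ℕ →₀ ℕ)} {m : ℕ →₀ ℕ} {i : ℕ} (hi : m i ≠ 0)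
    (hM : ∀ v, v + Finsupp.single i 1 ≤ m → v i + 1 = m i →
      (v + Finsupp.single i 1 ∈ M ↔ v ∈ M)) :
    MvPowerSeries.coeff m (moebiusX * hilbertX M) = 0 := by
  classical
  rw [coeff_moebius_mul_hilbert]
  have hcancel : ∀ s v : ℕ →₀ ℕ, s + (v + Finsupp.single i 1) = m → s i = 0 →
      MvPowerSeries.coeff s moebiusX *
        MvPowerSeries.coeff (v + Finsupp.single i 1) (hilbertX M) +
      MvPowerSeries.coeff (s + Finsupp.single i 1) moebiusX *
        MvPowerSeries.coeff v (hilbertX M) = 0 := by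
    intro s v hsv hs
    have h1 : v i + 1 = m i := by
      rw [← hsv]
      simp [hs]
    rw [coeff_moebiusX_add_single hs, coeff_hilbertX, coeff_hilbertX]
    simp only [hM v (hsv ▸ le_add_self) h1]
    ring
  -- The involution moves a factor `x_i` between the squarefree divisor and its cofactor; the terms
  -- with exponent at least `2` of `x_i` in the divisor vanish and are kept fixed.
  refine Finset.sum_involution
    (fun p _ => if p.1 i = 0 then (p.1 + Finsupp.single i 1, p.2 - Finsupp.single i 1)
      else if p.1 i = 1 then (p.1 - Finsupp.single i 1, p.2 + Finsupp.single i 1) else p)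
    ?_ ?_ ?_ ?_
  · intro p hp
    rw [Finset.HasAntidiagonal.mem_antidiagonal] at hp
    have hpi : p.1 i + p.2 i = m i := by rw [← hp, Finsupp.add_apply]
    split_ifs with h0 h1
    · have hv : p.2 - Finsupp.single i 1 + Finsupp.single i 1 = p.2 :=
        tsub_add_cancel_of_le (Finsupp.single_le_iff.2 (by omega))
      have := hcancel p.1 (p.2 - Finsupp.single i 1) (by rw [hv, hp]) h0
      rwa [hv] at this
    · have hs : p.1 - Finsupp.single i 1 + Finsupp.single i 1 = p.1 :=
        tsub_add_cancel_of_le (Finsupp.single_le_iff.2 (by omega))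
      have := hcancel (p.1 - Finsupp.single i 1) p.2 (by
        rw [add_comm p.2, ← add_assoc, hs, hp]) (by simp [h1])
      rw [hs] at this
      rw [add_comm]
      exact this
    · have : ¬ ∀ j, p.1 j ≤ 1 := fun H => by
        have := H i
        omega
      rw [coeff_moebiusX, if_neg this]
      simp
  · intro p hp hne
    have hp1 : ∀ j, p.1 j ≤ 1 := by
      by_contra hcon
      rw [coeff_moebiusX, if_neg hcon, zero_mul] at hne
      exact hne rfl
    have := hp1 i
    split_ifs with h0 h1
    · intro heq
      have := congrArg (fun p : (ℕ →₀ ℕ) × (ℕ →₀ ℕ) => p.1 i) heq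
      simp at this
    · intro heq
      have := congrArg (fun p : (ℕ →₀ ℕ) × (ℕ →₀ ℕ) => p.2 i) heq
      simp at this
    · omega
  · intro p hp
    rw [Finset.HasAntidiagonal.mem_antidiagonal] at hp ⊢
    have hpi : p.1 i + p.2 i = m i := by rw [← hp, Finsupp.add_apply]
    split_ifs with h0 h1
    · have hv : p.2 - Finsupp.single i 1 + Finsupp.single i 1 = p.2 :=
        tsub_add_cancel_of_le (Finsupp.single_le_iff.2 (by omega))
      rw [add_assoc, add_comm (Finsupp.single i 1), hv, hp]
    · have hs : p.1 - Finsupp.single i 1 + Finsupp.single i 1 = p.1 :=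
        tsub_add_cancel_of_le (Finsupp.single_le_iff.2 (by omega))
      rw [add_comm p.2, ← add_assoc, hs, hp]
    · exact hp
  · intro p hp
    rw [Finset.HasAntidiagonal.mem_antidiagonal] at hp
    have hpi : p.1 i + p.2 i = m i := by rw [← hp, Finsupp.add_apply]
    by_cases h0 : p.1 i = 0
    · have hv : p.2 - Finsupp.single i 1 + Finsupp.single i 1 = p.2 :=
        tsub_add_cancel_of_le (Finsupp.single_le_iff.2 (by omega))
      simp [h0, hv]
    · by_cases h1 : p.1 i = 1
      · have hs : p.1 - Finsupp.single i 1 + Finsupp.single i 1 = p.1 :=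
          tsub_add_cancel_of_le (Finsupp.single_le_iff.2 (by omega))
        simp [h1, hs]
      · simp [h0, h1]

/-- If up to the degree of `m` the set `M` consists of the multiples of monomials in `B`, and some
variable has a larger exponent in `m` than in every element of `B`, then `m` does not occur in
the numerator of `M`. -/
theorem coeff_numerator_eq_zero_of_generators {M : Set (ℕ →₀ ℕ)} {B : Set (ℕ →₀ ℕ)}
    {m : ℕ →₀ ℕ} (hB : ∀ v, v.degree ≤ m.degree → (v ∈ M ↔ ∃ b ∈ B, b ≤ v)) {i : ℕ}
    (hi : m i ≠ 0) (hBi : ∀ b ∈ B, b i < m i) :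
    MvPowerSeries.coeff m (moebiusX * hilbertX M) = 0 := by
  refine coeff_numerator_eq_zero hi fun v hv hvi => ?_
  have hdeg : ∀ a : ℕ →₀ ℕ, a ≤ m → a.degree ≤ m.degree := fun a ha => by
    have := congrArg Finsupp.degree (add_tsub_cancel_of_le ha)
    rw [map_add] at this
    omega
  rw [hB _ (hdeg _ hv), hB _ (hdeg _ (le_self_add.trans hv))]
  refine exists_congr fun b => and_congr_right fun hb => ⟨fun hle j => ?_, fun hle =>
    hle.trans le_self_add⟩
  by_cases hj : i = j
  · subst hj
    have := hBi b hb
    omega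
  · have := hle j
    rwa [Finsupp.add_apply, Finsupp.single_apply, if_neg hj, add_zero] at this

open Classical in
theorem coeff_prod_one_sub_X (n : ℕ) (m : Fin n →₀ ℕ) :
    MvPowerSeries.coeff m (∏ i : Fin n, (1 - MvPowerSeries.X i) : MvPowerSeries (Fin n) ℤ) =
      if ∀ i, m i ≤ 1 then (-1) ^ m.degree else 0 := by
  have hexp : (∏ i : Fin n, (1 - MvPowerSeries.X i) : MvPowerSeries (Fin n) ℤ) =
      ∑ t ∈ (Finset.univ : Finset (Fin n)).powerset,
        MvPowerSeries.monomial (∑ i ∈ t, Finsupp.single i 1) ((-1) ^ t.card) := by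
    simp only [sub_eq_add_neg]
    rw [Finset.prod_one_add]
    refine Finset.sum_congr rfl fun t ht => ?_
    clear ht
    induction t using Finset.induction_on with
    | empty => simp
    | insert a t ha ih =>
      rw [Finset.prod_insert ha, ih, Finset.sum_insert ha, Finset.card_insert_of_notMem ha,
        MvPowerSeries.X, ← map_neg, MvPowerSeries.monomial_mul_monomial, pow_succ']
  have hval : ∀ (t : Finset (Fin n)) (j : Fin n),
      (∑ i ∈ t, Finsupp.single i 1 : Fin n →₀ ℕ) j = if j ∈ t then 1 else 0 := by
    intro t j
    rw [Finsupp.finsetSum_apply]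
    simp [Finsupp.single_apply]
  rw [hexp, map_sum]
  split_ifs with hm
  · have hsupp : ∑ i ∈ m.support, Finsupp.single i 1 = m := by
      ext j
      rw [hval]
      have := hm j
      split_ifs with hj
      · have := Finsupp.mem_support_iff.1 hj
        omega
      · exact (Finsupp.notMem_support_iff.1 hj).symm
    rw [Finset.sum_eq_single m.support]
    · rw [hsupp, MvPowerSeries.coeff_monomial_same]
      congr 1
      conv_rhs => rw [← hsupp]
      rw [map_sum]
      simp [Finsupp.degree_single]
    · intro t _ hne
      rw [MvPowerSeries.coeff_monomial, if_neg]
      rintro heq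
      refine hne ?_
      ext j
      rw [Finsupp.mem_support_iff, heq, hval]
      simp
    · intro hcon
      exact absurd (Finset.mem_powerset.2 (Finset.subset_univ _)) hcon
  · refine Finset.sum_eq_zero fun t _ => ?_
    rw [MvPowerSeries.coeff_monomial, if_neg]
    rintro rfl
    refine hm fun j => ?_
    rw [hval]
    split_ifs <;> omega

theorem killCompl_moebiusX (n : ℕ) :
    MvPowerSeries.killCompl (Fin.valEmbedding (n := n)) moebiusX =
      (∏ i : Fin n, (1 - MvPowerSeries.X i) : MvPowerSeries (Fin n) ℤ) := by
  classical
  ext m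
  rw [MvPowerSeries.coeff_killCompl, coeff_prod_one_sub_X, coeff_moebiusX, degree_emb]
  have hiff : (∀ i, emb n m i ≤ 1) ↔ ∀ i, m i ≤ 1 := by
    constructor
    · intro h i
      rw [← emb_val m i]
      exact h i
    · intro h i
      by_cases hi : i < n
      · exact (emb_val m ⟨i, hi⟩).trans_le (h _)
      · rw [emb_of_le m (not_lt.1 hi)]
        exact zero_le
  simp only [hiff]

open Classical in
/-- The `[X]`-graded Hilbert series of the complement of a set of monomials in finitely many
variables. -/
def hilbertFin {n : ℕ} (M : Set (Fin n →₀ ℕ)) : MvPowerSeries (Fin n) ℤ :=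
  fun m => if m ∈ M then 0 else 1

/-- The `[X]`-graded Hilbert numerator of a set of monomials in finitely many variables. -/
def numeratorFin {n : ℕ} (M : Set (Fin n →₀ ℕ)) : MvPowerSeries (Fin n) ℤ :=
  (∏ i : Fin n, (1 - MvPowerSeries.X i)) * hilbertFin M

theorem numeratorFin_eq_killCompl {n : ℕ} (L : Set (ℕ →₀ ℕ)) :
    numeratorFin (emb n ⁻¹' L) =
      MvPowerSeries.killCompl (Fin.valEmbedding (n := n)) (moebiusX * hilbertX L) := by
  rw [map_mul, killCompl_moebiusX]
  rfl

/-- The numerator at `m` depends only on the members of `L` of degree at most that of `m`. -/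
theorem coeff_numerator_congr {L L' : Set (ℕ →₀ ℕ)} {m : ℕ →₀ ℕ}
    (hL : ∀ v ≤ m, (v ∈ L ↔ v ∈ L')) :
    MvPowerSeries.coeff m (moebiusX * hilbertX L) =
      MvPowerSeries.coeff m (moebiusX * hilbertX L') := by
  classical
  rw [coeff_moebius_mul_hilbert, coeff_moebius_mul_hilbert]
  refine Finset.sum_congr rfl fun p hp => ?_
  rw [Finset.HasAntidiagonal.mem_antidiagonal] at hp
  rw [coeff_hilbertX, coeff_hilbertX]
  simp only [hL p.2 (hp ▸ le_add_self)]

/-- The extension to infinitely many variables of a set of monomials in finitely many. -/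
def extend {n : ℕ} (M : Set (Fin n →₀ ℕ)) : Set (ℕ →₀ ℕ) := {m | ∃ a ∈ M, emb n a ≤ m}

theorem preimage_extend {n : ℕ} {M : Set (Fin n →₀ ℕ)} (hM : ∀ a ∈ M, ∀ b, a ≤ b → b ∈ M) :
    emb n ⁻¹' extend M = M := by
  ext m
  constructor
  · rintro ⟨a, ha, hle⟩
    exact hM a ha m (emb_le_emb.1 hle)
  · exact fun hm => ⟨m, hm, le_rfl⟩

/-- Dickson's lemma. -/
theorem exists_finite_generators {σ : Type*} [Finite σ] (M : Set (σ →₀ ℕ)) :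
    ∃ B : Set (σ →₀ ℕ), B.Finite ∧ B ⊆ M ∧ ∀ m ∈ M, ∃ b ∈ B, b ≤ m := by
  refine ⟨{b | Minimal (· ∈ M) b}, ?_, fun b hb => hb.1, fun m hm => ?_⟩
  · exact WellQuasiOrderedLE.finite_of_isAntichain (setOfPred_minimal_antichain _)
  · obtain ⟨b, hle, hb⟩ := exists_minimal_le_of_wellFoundedLT (· ∈ M) m hm
    exact ⟨b, hb, hle⟩

theorem finite_support_numeratorFin {n : ℕ} {M : Set (Fin n →₀ ℕ)}
    (hM : ∀ a ∈ M, ∀ b, a ≤ b → b ∈ M) :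
    {m | MvPowerSeries.coeff m (numeratorFin M) ≠ 0}.Finite := by
  obtain ⟨B, hBfin, hBM, hB⟩ := exists_finite_generators M
  obtain ⟨c, hc⟩ := hBfin.bddAbove
  refine (Set.finite_Iic c).subset fun m hm => ?_
  rw [Set.mem_Iic]
  intro i
  by_contra hcon
  push Not at hcon
  refine hm ?_
  rw [← preimage_extend hM, numeratorFin_eq_killCompl, MvPowerSeries.coeff_killCompl]
  refine coeff_numerator_eq_zero_of_generators (B := emb n '' B) (i := i) ?_ ?_ ?_
  · intro v _
    constructor
    · rintro ⟨a, ha, hle⟩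
      obtain ⟨b, hb, hba⟩ := hB a ha
      exact ⟨emb n b, ⟨b, hb, rfl⟩, (emb_le_emb.2 hba).trans hle⟩
    · rintro ⟨_, ⟨b, hb, rfl⟩, hle⟩
      exact ⟨b, hBM hb, hle⟩
  · change emb n m i ≠ 0
    rw [emb_val]
    omega
  · rintro _ ⟨b, hb, rfl⟩
    change emb n b i < emb n m i
    rw [emb_val, emb_val]
    exact (hc hb i).trans_lt hcon

theorem exists_polynomial_coe_eq {σ R : Type*} [CommRing R] (f : MvPowerSeries σ R)
    (hf : {m | MvPowerSeries.coeff m f ≠ 0}.Finite) :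
    ∃ p : MvPolynomial σ R, (p : MvPowerSeries σ R) = f := by
  classical
  refine ⟨∑ m ∈ hf.toFinset, MvPolynomial.monomial m (MvPowerSeries.coeff m f), ?_⟩
  ext m
  rw [MvPolynomial.coeff_coe, MvPolynomial.coeff_sum]
  simp only [MvPolynomial.coeff_monomial, Finset.sum_ite_eq', Set.Finite.mem_toFinset,
    Set.mem_ofPred_eq]
  split_ifs with h
  · rfl
  · exact (not_not.mp h).symm

/-! ### Hilbert series of the truncated quotients -/

section Hilbert

variable {K : Type*} [Field K] {lt : (ℕ →₀ ℕ) → (ℕ →₀ ℕ) → Prop} {r : ℕ}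

/-- The multidegree of a monomial in the first `n` variables. -/
abbrev wdeg (y : ℕ → Fin r) (n : ℕ) : (Fin n →₀ ℕ) →+ (Fin r →₀ ℕ) :=
  Finsupp.weight fun i : Fin n => Finsupp.single (y i) 1

theorem weight_single_eq_mapDomain {σ τ : Type*} (y : σ → τ) (m : σ →₀ ℕ) :
    Finsupp.weight (fun i => (Finsupp.single (y i) 1 : τ →₀ ℕ)) m = Finsupp.mapDomain y m := by
  rw [Finsupp.weight_apply, Finsupp.mapDomain]
  refine Finsupp.sum_congr fun i _ => ?_
  rw [Finsupp.smul_single, smul_eq_mul, mul_one]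

theorem degree_mdeg (y : ℕ → Fin r) (m : ℕ →₀ ℕ) : (mdeg y m).degree = m.degree := by
  rw [mdeg, weight_single_eq_mapDomain, Finsupp.degree_mapDomain]

theorem degree_wdeg (y : ℕ → Fin r) {n : ℕ} (m : Fin n →₀ ℕ) :
    (wdeg y n m).degree = m.degree := by
  rw [wdeg, weight_single_eq_mapDomain (fun i : Fin n => y i), Finsupp.degree_mapDomain]

theorem mdeg_emb (y : ℕ → Fin r) {n : ℕ} (m : Fin n →₀ ℕ) : mdeg y (emb n m) = wdeg y n m := by
  rw [mdeg, wdeg, weight_single_eq_mapDomain, weight_single_eq_mapDomain (fun i : Fin n => y i),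
    emb, Finsupp.embDomain_eq_mapDomain, ← Finsupp.mapDomain_comp]
  rfl

theorem coef_component (y : ℕ → Fin r) (α : Fin r →₀ ℕ) (f : RP K) (m : ℕ →₀ ℕ) :
    coef m (component y α f) = if mdeg y m = α then coef m f else 0 := rfl

/-- An initial monomial of a truncated multihomogeneous ideal is the initial monomial of a
multihomogeneous element. -/
theorem exists_homogeneous_isInitialFin {y : ℕ → Fin r} {I : Ideal (RP K)}
    (hI : IsMultihomogeneous y I) {n : ℕ} {m : Fin n →₀ ℕ}
    (hm : m ∈ initialMonomialsFin lt (I.map (truncate K n))) :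
    ∃ f ∈ I.map (truncate K n), IsInitialFin lt f m ∧
      ∀ a, f.coeff a ≠ 0 → wdeg y n a = wdeg y n m := by
  obtain ⟨_, hmap, hin⟩ := hm
  obtain ⟨f, hf, rfl⟩ := mem_map_truncate.1 hmap
  have hcoeff : ∀ a, (truncate K n (component y (wdeg y n m) f)).coeff a =
      if wdeg y n a = wdeg y n m then (truncate K n f).coeff a else 0 := by
    intro a
    rw [coeff_truncate, coef_component, coeff_truncate, mdeg_emb]
  refine ⟨truncate K n (component y (wdeg y n m) f),
    Ideal.mem_map_of_mem _ (hI f hf _), ⟨?_, ?_⟩, ?_⟩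
  · rw [hcoeff, if_pos rfl]
    exact hin.1
  · intro a ha
    rw [hcoeff] at ha
    exact hin.2 a fun h0 => ha (by rw [h0, ite_self])
  · intro a ha
    rw [hcoeff] at ha
    by_contra hne
    exact ha (if_neg hne)

/-- The standard monomials, those that are not initial monomials of the ideal, of multidegree `α`
form a basis of the component of multidegree `α` of the quotient. -/
theorem finrank_component_eq_card (h : IsTermOrder lt) {y : ℕ → Fin r} {I : Ideal (RP K)}
    (hI : IsMultihomogeneous y I) {n : ℕ} (α : Fin r →₀ ℕ) {S : Finset (Fin n →₀ ℕ)}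
    (hS : ∀ m, m ∈ S ↔ wdeg y n m = α ∧ m ∉ initialMonomialsFin lt (I.map (truncate K n))) :
    Module.finrank K (Submodule.map
      (Ideal.Quotient.mkₐ K (I.map (truncate K n))).toLinearMap
      (MvPolynomial.weightedHomogeneousSubmodule K
        (fun i : Fin n => (Finsupp.single (y i) 1 : Fin r →₀ ℕ)) α)) = S.card := by
  set J := I.map (truncate K n) with hJ
  set φ := (Ideal.Quotient.mkₐ K J).toLinearMap with hφ
  have hφ0 : ∀ f, φ f = 0 ↔ f ∈ J := fun f => Ideal.Quotient.eq_zero_iff_mem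
  let v : S → MvPolynomial (Fin n) K ⧸ J := fun m => φ (MvPolynomial.monomial (m : Fin n →₀ ℕ) 1)
  have hfib : ∀ m : Fin n →₀ ℕ, wdeg y n m = α → m.degree = α.degree := fun m hm => by
    rw [← degree_wdeg y m, hm]
  have hli : LinearIndependent K v := by
    classical
    rw [Fintype.linearIndependent_iff]
    intro c hc
    by_contra hne
    push Not at hne
    obtain ⟨a, ha⟩ := hne
    set f : MvPolynomial (Fin n) K := ∑ m : S, c m • MvPolynomial.monomial (m : Fin n →₀ ℕ) 1
      with hf
    have hcoeff : ∀ m : S, f.coeff m = c m := by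
      intro m
      rw [hf, MvPolynomial.coeff_sum, Finset.sum_eq_single m]
      · simp
      · intro b _ hb
        rw [MvPolynomial.coeff_smul, MvPolynomial.coeff_monomial,
          if_neg (fun h' => hb (Subtype.ext h')), smul_zero]
      · simp
    have hsupp : ∀ m, f.coeff m ≠ 0 → m ∈ S := by
      intro m hm
      rw [hf, MvPolynomial.coeff_sum] at hm
      obtain ⟨b, -, hb⟩ := Finset.exists_ne_zero_of_sum_ne_zero hm
      rw [MvPolynomial.coeff_smul, MvPolynomial.coeff_monomial] at hb
      split_ifs at hb with heq
      · exact heq ▸ b.2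
      · simp at hb
    have hfJ : f ∈ J := by
      rw [← hφ0, hf, map_sum]
      simpa only [map_smul] using hc
    obtain ⟨ν, hν, hmax⟩ := exists_greatest h (P := {m | f.coeff m ≠ 0}) (e := α.degree)
      (fun m hm => hfib m ((hS m).1 (hsupp m hm)).1)
      ⟨a, by
        change f.coeff a ≠ 0
        rwa [hcoeff]⟩
    exact ((hS ν).1 (hsupp ν hν)).2 ⟨f, hfJ, hν, fun m hm => (hmax m hm).imp_right fun h' => h'.2⟩
  have hspan : Submodule.span K (Set.range v) = Submodule.map φ
      (MvPolynomial.weightedHomogeneousSubmodule K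
        (fun i : Fin n => (Finsupp.single (y i) 1 : Fin r →₀ ℕ)) α) := by
    apply le_antisymm
    · refine Submodule.span_le.2 ?_
      rintro _ ⟨m, rfl⟩
      exact ⟨_, MvPolynomial.isWeightedHomogeneous_monomial _ _ _ ((hS m).1 m.2).1, rfl⟩
    · -- Monomials reduce to standard ones, by induction on the number of smaller monomials.
      have hmono : ∀ k, ∀ m : Fin n →₀ ℕ, (belowFin lt m).ncard = k → wdeg y n m = α →
          φ (MvPolynomial.monomial m 1) ∈ Submodule.span K (Set.range v) := by
        intro k
        induction k using Nat.strong_induction_on with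
        | h k ih =>
          intro m hk hm
          by_cases hstd : m ∈ initialMonomialsFin lt J
          · obtain ⟨f, hfJ, hin, hhom⟩ := exists_homogeneous_isInitialFin hI hstd
            rw [← hJ] at hfJ
            set g := MvPolynomial.monomial m 1 - (f.coeff m)⁻¹ • f with hg
            have hφg : φ (MvPolynomial.monomial m 1) = φ g := by
              rw [hg, map_sub, map_smul, (hφ0 f).2 hfJ, smul_zero, sub_zero]
            rw [hφg, g.as_sum, map_sum]
            refine sum_mem fun a ha => ?_
            have hsmul : MvPolynomial.monomial a (g.coeff a) =
                g.coeff a • MvPolynomial.monomial a (1 : K) := by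
              rw [MvPolynomial.smul_monomial, smul_eq_mul, mul_one]
            rw [hsmul, map_smul]
            refine Submodule.smul_mem _ _ ?_
            have ha' := MvPolynomial.mem_support_iff.1 ha
            have ham : a ≠ m := by
              rintro rfl
              refine ha' ?_
              rw [hg, MvPolynomial.coeff_sub, MvPolynomial.coeff_smul,
                MvPolynomial.coeff_monomial, if_pos rfl, smul_eq_mul,
                inv_mul_cancel₀ hin.1, sub_self]
            have haf : f.coeff a ≠ 0 := by
              intro h0
              refine ha' ?_
              rw [hg, MvPolynomial.coeff_sub, MvPolynomial.coeff_smul,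
                MvPolynomial.coeff_monomial, if_neg ham.symm, h0, smul_zero, sub_zero]
            have haw : wdeg y n a = α := (hhom a haf).trans hm
            have hlt := (hin.2 a haf).resolve_left ham
            have hdeg : a.degree = m.degree := (hfib a haw).trans (hfib m hm).symm
            refine ih _ ?_ a rfl haw
            rw [← hk]
            refine Set.ncard_lt_ncard ⟨fun b hb => ⟨hb.1.trans hdeg, h.trans hb.2 hlt⟩,
              fun hcon => h.irrefl _ (hcon ⟨hdeg, hlt⟩).2⟩ ?_
            exact (Finsupp.finite_of_degree_le (σ := Fin n) m.degree).subset fun b hb => hb.1.le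
          · exact Submodule.subset_span ⟨⟨m, (hS m).2 ⟨hm, hstd⟩⟩, rfl⟩
      rintro _ ⟨f, hf, rfl⟩
      rw [f.as_sum, map_sum]
      refine sum_mem fun a ha => ?_
      have hsmul : MvPolynomial.monomial a (f.coeff a) =
          f.coeff a • MvPolynomial.monomial a (1 : K) := by
        rw [MvPolynomial.smul_monomial, smul_eq_mul, mul_one]
      rw [hsmul, map_smul]
      exact Submodule.smul_mem _ _ (hmono _ a rfl (hf (MvPolynomial.mem_support_iff.1 ha)))
  rw [← hspan, finrank_span_eq_card hli, Fintype.card_coe]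

/-- The multigraded Hilbert series of a truncated quotient is the image under `x_i ↦ t_{y i}` of the
series of the standard monomials. -/
theorem hilbertSeries_eq_rename (h : IsTermOrder lt) {y : ℕ → Fin r} {I : Ideal (RP K)}
    (hI : IsMultihomogeneous y I) (n : ℕ) :
    hilbertSeries y (I.map (truncate K n)) =
      MvPowerSeries.rename (fun i : Fin n => y i)
        (hilbertFin (initialMonomialsFin lt (I.map (truncate K n)))) := by
  classical
  ext α
  rw [MvPowerSeries.coeff_rename]
  set T := (TendstoCofinite.finite_preimage_singleton
    (Finsupp.mapDomain (M := ℕ) fun i : Fin n => y i) α).toFinset with hT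
  have hmem : ∀ m, m ∈ T ↔ wdeg y n m = α := by
    intro m
    rw [hT, Set.Finite.mem_toFinset, wdeg, weight_single_eq_mapDomain (fun i : Fin n => y i)]
    rfl
  have hcard := finrank_component_eq_card (K := K) h hI (n := n) α
    (S := T.filter (· ∉ initialMonomialsFin lt (I.map (truncate K n)))) (fun m => by
      rw [Finset.mem_filter, hmem])
  change ((Module.finrank K _ : ℕ) : ℤ) = _
  rw [hcard, Finset.card_filter, Nat.cast_sum]
  refine Finset.sum_congr rfl fun m _ => ?_
  change _ = if m ∈ initialMonomialsFin lt (I.map (truncate K n)) then (0 : ℤ) else 1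
  split_ifs <;> simp_all

end Hilbert

/-! ### Convergence -/

/-- A power series in finitely many variables without terms of degree less than `k` lies in the
`k`-th power of the ideal generated by the variables. -/
theorem mem_span_X_pow {σ R : Type*} [Fintype σ] [CommRing R] (k : ℕ) (f : MvPowerSeries σ R)
    (hf : ∀ m : σ →₀ ℕ, m.degree < k → MvPowerSeries.coeff m f = 0) :
    f ∈ Ideal.span (Set.range (MvPowerSeries.X : σ → MvPowerSeries σ R)) ^ k := by
  classical
  induction k generalizing f with
  | zero => simp
  | succ k ih =>
    rcases isEmpty_or_nonempty σ with hσ | hσ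
    · have h0 : f = 0 := by
        ext m
        rw [hf m (by rw [Subsingleton.elim m 0, map_zero]; omega), map_zero]
      rw [h0]
      exact zero_mem _
    -- Every monomial other than `1` is assigned to one of the variables that divide it.
    have hpick : ∀ m : σ →₀ ℕ, m ≠ 0 → ∃ i, m i ≠ 0 := fun m hm => Finsupp.ne_iff.1 hm
    choose! pick hpick using hpick
    let q : σ → MvPowerSeries σ R := fun i m =>
      if pick (m + Finsupp.single i 1) = i then
        MvPowerSeries.coeff (m + Finsupp.single i 1) f else 0
    have hq : ∀ i m, MvPowerSeries.coeff m (q i) =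
        if pick (m + Finsupp.single i 1) = i then
          MvPowerSeries.coeff (m + Finsupp.single i 1) f else 0 := fun _ _ => rfl
    have hsum : f = ∑ i, MvPowerSeries.X i * q i := by
      ext m
      rw [map_sum]
      have hterm : ∀ i, MvPowerSeries.coeff m (MvPowerSeries.X i * q i) =
          if Finsupp.single i 1 ≤ m ∧ pick m = i then MvPowerSeries.coeff m f else 0 := by
        intro i
        rw [MvPowerSeries.X, MvPowerSeries.coeff_monomial_mul, one_mul]
        by_cases hle : Finsupp.single i 1 ≤ m
        · rw [if_pos hle, hq, tsub_add_cancel_of_le hle]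
          simp only [hle, true_and]
        · rw [if_neg hle, if_neg fun H => hle H.1]
      simp only [hterm]
      by_cases hm : m = 0
      · rw [hf m (by rw [hm, map_zero]; omega)]
        simp
      · rw [Finset.sum_eq_single (pick m) (fun i _ hi => if_neg fun H => hi H.2.symm)
          (fun H => absurd (Finset.mem_univ _) H), if_pos]
        exact ⟨Finsupp.single_le_iff.2 (Nat.one_le_iff_ne_zero.2 (hpick m hm)), rfl⟩
    rw [hsum, pow_succ']
    refine Ideal.sum_mem _ fun i _ => Ideal.mul_mem_mul (Ideal.subset_span ⟨i, rfl⟩) (ih _ ?_)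
    intro m hm
    rw [hq, hf _ (by rw [map_add, Finsupp.degree_single]; omega), ite_self]

section

variable {K : Type*} [Field K] {lt : (ℕ →₀ ℕ) → (ℕ →₀ ℕ) → Prop} {r : ℕ}

theorem numeratorX_initialIdeal (h : IsTermOrder lt) (I : Ideal (RP K)) :
    numeratorX (initialIdeal lt I) = moebiusX * hilbertX (initialMonomials lt I) := by
  rw [numeratorX, monomialsOf_initialIdeal h]

/-- In degrees at most `d` the numerator of the initial ideal involves only the variables that
occur in the generators of degree at most `d`. -/
theorem coeff_numeratorX_eq_zero (h : IsTermOrder lt) {I : Ideal (RP K)} {d N : ℕ}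
    {B : Finset (ℕ →₀ ℕ)} (hBN : ∀ b ∈ B, ∀ i, N ≤ i → b i = 0)
    (hB : ∀ m : ℕ →₀ ℕ, m.degree ≤ d → (m ∈ initialMonomials lt I ↔ ∃ b ∈ B, b ≤ m))
    {m : ℕ →₀ ℕ} (hm : m.degree ≤ d) {i : ℕ} (hi : N ≤ i) (hmi : m i ≠ 0) :
    MvPowerSeries.coeff m (numeratorX (initialIdeal lt I)) = 0 := by
  rw [numeratorX_initialIdeal h]
  refine coeff_numerator_eq_zero_of_generators (B := B) (fun v hv => hB v (hv.trans hm)) hmi ?_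
  intro b hb
  rw [hBN b hb i hi]
  omega

theorem numeratorX_mem_collapsible (h : IsTermOrder lt) {I : Ideal (RP K)} (hI : IsLFG I) :
    numeratorX (initialIdeal lt I) ∈ collapsible := by
  intro d
  obtain ⟨B, N, hBN, -, hB⟩ := exists_common_generators h hI d
  refine ((Finsupp.finite_of_degree_le (σ := Fin N) d).image (emb N)).subset ?_
  rintro m ⟨hd, hm⟩
  obtain ⟨a, rfl⟩ : ∃ a, emb N a = m := by
    refine exists_emb_eq fun i hi => ?_
    by_contra hmi
    exact hm (coeff_numeratorX_eq_zero h hBN hB hd.le hi hmi)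
  exact ⟨a, by rw [degree_emb] at hd; exact hd.le, rfl⟩

/-- In degrees at most `d` the collapsed numerator of a truncation to sufficiently many variables
agrees with the collapsed numerator of the initial ideal. -/
theorem exists_coeff_rename_eq_collapse (h : IsTermOrder lt) (y : ℕ → Fin r) {I : Ideal (RP K)}
    (hI : IsLFG I) (hS : numeratorX (initialIdeal lt I) ∈ collapsible) (d : ℕ) :
    ∃ N, ∀ n ≥ N, ∀ α : Fin r →₀ ℕ, α.degree ≤ d →
      MvPowerSeries.coeff α (MvPowerSeries.rename (fun i : Fin n => y i)
        (numeratorFin (initialMonomialsFin lt (I.map (truncate K n))))) =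
      MvPowerSeries.coeff α (collapse y ⟨numeratorX (initialIdeal lt I), hS⟩) := by
  classical
  obtain ⟨B, N, hBN, hBn, hB⟩ := exists_common_generators h hI d
  refine ⟨N, fun n hn α hα => ?_⟩
  rw [MvPowerSeries.coeff_rename]
  set T := (TendstoCofinite.finite_preimage_singleton
    (Finsupp.mapDomain (M := ℕ) fun i : Fin n => y i) α).toFinset with hT
  have hmem : ∀ m, m ∈ T ↔ wdeg y n m = α := by
    intro m
    rw [hT, Set.Finite.mem_toFinset, wdeg, weight_single_eq_mapDomain (fun i : Fin n => y i)]
    rfl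
  have hdeg : ∀ m ∈ T, m.degree ≤ d := fun m hm => by
    rwa [← degree_wdeg y m, (hmem m).1 hm]
  have hcoeff : ∀ m ∈ T, MvPowerSeries.coeff m
      (numeratorFin (initialMonomialsFin lt (I.map (truncate K n)))) =
      MvPowerSeries.coeff (emb n m) (numeratorX (initialIdeal lt I)) := by
    intro m hm
    rw [← preimage_extend (M := initialMonomialsFin lt (I.map (truncate K n)))
      (fun a ha b hab => initialMonomialsFin_mono h _ hab ha), numeratorFin_eq_killCompl,
      MvPowerSeries.coeff_killCompl, numeratorX_initialIdeal h]
    refine coeff_numerator_congr fun v hv => ?_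
    obtain ⟨a, rfl⟩ : ∃ a, emb n a = v := exists_emb_eq fun i hi => by
      have := hv i
      rw [emb_of_le m hi] at this
      omega
    have ha : a.degree ≤ d := by
      have h1 := congrArg Finsupp.degree (add_tsub_cancel_of_le (emb_le_emb.1 hv))
      have h2 := hdeg m hm
      rw [map_add] at h1
      omega
    rw [hB _ ((degree_emb a).trans_le ha), ← hBn n hn a ha]
    exact Set.ext_iff.1 (preimage_extend
      (fun a ha b hab => initialMonomialsFin_mono h _ hab ha)) a
  rw [Finset.sum_congr rfl hcoeff, ← Finset.sum_image (s := T) (g := emb n)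
    (f := fun m => MvPowerSeries.coeff m (numeratorX (initialIdeal lt I)))
    (fun _ _ _ _ heq => emb_injective n heq)]
  symm
  refine finsum_mem_eq_sum_of_inter_support_eq (s := {m | mdeg y m = α}) _ ?_
  ext m
  simp only [Set.mem_inter_iff, Finset.coe_image, and_congr_left_iff]
  intro hm
  constructor
  · intro hmα
    have hmα' : mdeg y m = α := hmα
    have hmd : m.degree ≤ d := by rwa [← degree_mdeg y m, hmα']
    obtain ⟨a, rfl⟩ : ∃ a, emb n a = m := exists_emb_eq fun i hi => by
      by_contra hmi
      exact hm (coeff_numeratorX_eq_zero h hBN hB hmd (hn.trans hi) hmi)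
    exact ⟨a, (hmem a).2 (by rw [← mdeg_emb, hmα']), rfl⟩
  · rintro ⟨a, ha, rfl⟩
    change mdeg y (emb n a) = α
    rw [mdeg_emb]
    exact (hmem a).1 ha

end

end

end LargePoly

theorem mainTheorem1 (K : Type*) [Field K] [CharZero K] (r : ℕ) (y : ℕ → Fin r)
    (lt : (ℕ →₀ ℕ) → (ℕ →₀ ℕ) → Prop) (hlt : LargePoly.IsTermOrder lt)
    (I : Ideal (LargePoly.RP K)) (hI : LargePoly.IsMultihomogeneous y I)
    (hfg : LargePoly.IsLFG I) :
    ∃ (g : ℕ → MvPolynomial (Fin r) ℤ)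
      (hS : LargePoly.numeratorX (LargePoly.initialIdeal lt I) ∈ LargePoly.collapsible),
      (∀ n : ℕ, (g n : MvPowerSeries (Fin r) ℤ) =
        (∏ i : Fin n, (1 - MvPowerSeries.X (y i))) *
          LargePoly.hilbertSeries y (I.map (LargePoly.truncate K n))) ∧
      Tendsto (fun n => (g n : MvPowerSeries (Fin r) ℤ)) atTop
        (@nhds (MvPowerSeries (Fin r) ℤ)
          (Ideal.adicTopology
            (Ideal.span (Set.range (MvPowerSeries.X : Fin r → MvPowerSeries (Fin r) ℤ))))
          (LargePoly.collapse y
            ⟨LargePoly.numeratorX (LargePoly.initialIdeal lt I), hS⟩)) := by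
  open LargePoly in
  have hS := numeratorX_mem_collapsible hlt hfg
  have hpoly : ∀ n, ∃ p : MvPolynomial (Fin n) ℤ, (p : MvPowerSeries (Fin n) ℤ) =
      numeratorFin (initialMonomialsFin lt (I.map (truncate K n))) := fun n =>
    exists_polynomial_coe_eq _ (finite_support_numeratorFin
      fun a ha b hab => initialMonomialsFin_mono hlt _ hab ha)
  choose p hp using hpoly
  have hg : ∀ n, (MvPolynomial.rename (fun i : Fin n => y i) (p n) : MvPowerSeries (Fin r) ℤ) =
      MvPowerSeries.rename (fun i : Fin n => y i)
        (numeratorFin (initialMonomialsFin lt (I.map (truncate K n)))) := fun n => by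
    rw [← MvPowerSeries.rename_coe, hp]
  refine ⟨fun n => MvPolynomial.rename (fun i : Fin n => y i) (p n), hS, fun n => ?_, ?_⟩
  · rw [hg, numeratorFin, map_mul, map_prod, hilbertSeries_eq_rename hlt hI]
    simp only [map_sub, map_one, MvPowerSeries.rename_X]
  · rw [(Ideal.hasBasis_nhds_adic _ _).tendsto_right_iff]
    intro k _
    obtain ⟨N, hN⟩ := exists_coeff_rename_eq_collapse hlt y hfg hS k
    filter_upwards [eventually_ge_atTop N] with n hn
    refine ⟨_, mem_span_X_pow k _ fun α hα => ?_, add_sub_cancel _ _⟩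
    rw [map_sub, hg, hN n hn α hα.le, sub_self]
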